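/- **Theorem.** Let $p>0$. All functions below are defined on $\mathbb R$, and $H^1=H^1(\mathbb R)$ consists of complex-valued functions (identified when equal almost everywhere) unless stated otherwise. Write $$\|u\|^2=\tfrac12\|u'\|_{L^2}^2+\|u\|_{L^2}^2 .$$ The equation $-\tfrac12 z''+z=z^{2p+1}$ has exactly one positive even $C^2$ solution $z$ lying in $H^1$ and having least energy $\tfrac12\|u\|^2-\tfrac1{2p+2}\|u\|_{L^{2p+2}}^{2p+2}$ among all nonzero $H^1$ weak solutions $u$ of $-\tfrac12u''+u=|u|^{2p}u$. For $\beta>1$ consider the system $$ \begin{cases} -\frac12 u_1''+u_1=\big(|u_1|^{2p}+\beta|u_2|^{p+1}|u_1|^{p-1}\big)u_1,\\ -\frac12 u_2''+u_2=\big(|u_2|^{2p}+\beta|u_1|^{p+1}|u_2|^{p-1}\big)u_2, \end{cases} $$ its energy on $H^1\times H^1$ $$\mathcal I(u_1,u_2)=\tfrac12\big(\|u_1\|^2+\|u_2\|^2\big)-\tfrac1{2p+2}\int\big(|u_1|^{2p+2}+|u_2|^{2p+2}\big)-\tfrac{\beta}{p+1}\int|u_1u_2|^{p+1},$$ and the Nehari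 set $$\mathcal N=\Big\{(u_1,u_2)\in H^1\times H^1:\ u_i\ne0,\ \|u_i\|^2=\int|u_i|^{2p+2}+\beta\int|u_1u_2|^{p+1},\ i=1,2\Big\}.$$ A *ground state* is a weak solution in $H^1\times H^1$ with both components nonzero that has least energy $\mathcal I$ among all such solutions. A ground state $R=(r_1,r_2)$ with nonnegative components is *non-degenerate* if $\partial_xR\neq0$ and the real $H^1\times H^1$ weak solutions $(\varphi,\psi)$ of the linearized system $$ \begin{cases} -\frac12\varphi''+\varphi=\big[(2p+1)r_1^{2p}+\beta p\,r_1^{p-1}r_2^{p+1}\big]\varphi+\beta(p+1)r_1^pr_2^p\,\psi,\\ -\frac12\psi''+\psi=\big[(2p+1)r_2^{2p}+\beta p\,r_1^{p+1}r_2^{p-1}\big]\psi+\beta(p+1)r_1^pr_2^p\,\varphi \end{cases} $$ are exactly the multiples $\theta\,\partial_xR$, $\theta\in\mathbb R$. Let $a=(1+\beta)^{-1/(2p)}$ and $Z=a(z,z)$. Then, for every $p>0$ and $\beta>1$: 1. $Z$ is a ground state of the system, and $Z\in\mathcal N$ with $\mathcal I(Z)=\min_{\mathcal N}\mathcal I$.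 2. If moreover $2^p\le 1+\beta$ (automatic for $p\le1$), then $Z$ has least energy among all nonzero weak solutions in $H^1\times H^1$, including those with one vanishing component. 3. If $p\ne\beta$, then $Z$ is a non-degenerate ground state. -/

import Mathlib

open MeasureTheory
open scoped ContDiff ComplexConjugate

noncomputable section

/-! ### The Sobolev space `H¹(ℝ)` -/

section Sobolev

/-- `g` is the weak (distributional) derivative of `u` on the real line. -/
def HasWeakDeriv {E : Type*} [NormedAddCommGroup E] [NormedSpace ℝ E] (u g : ℝ → E) : Prop :=
  LocallyIntegrable u volume ∧ LocallyIntegrable g volume ∧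
    ∀ η : ℝ → ℝ, ContDiff ℝ ∞ η → HasCompactSupport η →
      ∫ x, deriv η x • u x = -∫ x, η x • g x

/-- `u` (a function, identified as usual with its class modulo null sets) belongs to `H¹(ℝ)`:
both `u` and its weak derivative are square integrable. -/
def MemH1 {E : Type*} [NormedAddCommGroup E] [NormedSpace ℝ E] (u : ℝ → E) : Prop :=
  MemLp u 2 volume ∧ ∃ g : ℝ → E, MemLp g 2 volume ∧ HasWeakDeriv u g

open Classical in
/-- A square integrable representative of the weak derivative of an `H¹` function (it is unique
almost everywhere); `0` for functions outside `H¹`. -/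
def weakDeriv {E : Type*} [NormedAddCommGroup E] [NormedSpace ℝ E] (u : ℝ → E) : ℝ → E :=
  if h : ∃ g : ℝ → E, MemLp g 2 volume ∧ HasWeakDeriv u g then h.choose else 0

/-- The squared norm `½ ‖u'‖₂² + ‖u‖₂²` on `H¹(ℝ)`, the quadratic form of `-½ ∂ₓₓ + 1`. -/
def energyNormSq (u : ℝ → ℂ) : ℝ :=
  (1 / 2) * (∫ x, ‖weakDeriv u x‖ ^ 2) + ∫ x, ‖u x‖ ^ 2

/-- The sesquilinear form of `-½ ∂ₓₓ + 1`. -/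
def energyForm (u φ : ℝ → ℂ) : ℂ :=
  (1 / 2) * (∫ x, weakDeriv u x * conj (weakDeriv φ x)) + ∫ x, u x * conj (φ x)

/-- The real bilinear form of `-½ ∂ₓₓ + 1`. -/
def energyFormReal (u φ : ℝ → ℝ) : ℝ :=
  (1 / 2) * (∫ x, weakDeriv u x * weakDeriv φ x) + ∫ x, u x * φ x

/-- A real function regarded as a complex valued one. -/
def toComplex (r : ℝ → ℝ) : ℝ → ℂ := fun x => (r x : ℂ)

end Sobolev

/-! ### The scalar equation `-½ z'' + z = |z|^(2p) z` -/

section Scalar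

/-- `u ∈ H¹(ℝ, ℂ)` is a (weak) solution of `-½ u'' + u = |u|^(2p) u`. -/
def IsScalarSolution (p : ℝ) (u : ℝ → ℂ) : Prop :=
  MemH1 u ∧ ∀ φ : ℝ → ℂ, MemH1 φ →
    energyForm u φ = ∫ x, ((‖u x‖ ^ (2 * p) : ℝ) : ℂ) * u x * conj (φ x)

/-- The energy `½ (½‖u'‖₂² + ‖u‖₂²) - ‖u‖_{2p+2}^{2p+2} / (2p+2)` whose critical points are the
solutions of the scalar equation. -/
def scalarAction (p : ℝ) (u : ℝ → ℂ) : ℝ :=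
  (1 / 2) * energyNormSq u - 1 / (2 * p + 2) * ∫ x, ‖u x‖ ^ (2 * p + 2)

/-- `z` is a positive radial (i.e. even) least energy solution of `-½ z'' + z = z^(2p+1)`. -/
structure IsScalarGroundState (p : ℝ) (z : ℝ → ℝ) : Prop where
  contDiff : ContDiff ℝ 2 z
  pos : ∀ x, 0 < z x
  even : ∀ x, z (-x) = z x
  equation : ∀ x, -(1 / 2) * deriv (deriv z) x + z x = z x ^ (2 * p + 1)
  solution : IsScalarSolution p (toComplex z)
  least : ∀ u : ℝ → ℂ, IsScalarSolution p u → ¬ u =ᵐ[volume] 0 →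
    scalarAction p (toComplex z) ≤ scalarAction p u

end Scalar

/-! ### The coupled system -/

section System

/-- `(u₁, u₂) ∈ H¹ × H¹` is a (weak) solution of
`-½ u₁'' + u₁ = (|u₁|^(2p) + β |u₂|^(p+1) |u₁|^(p-1)) u₁` and of the symmetric equation for `u₂`.
For nonnegative components the right-hand side is `u₁^(2p+1) + β u₁^p u₂^(p+1)`. (Where `u₁`
vanishes the nonlinearity vanishes, also for `p ≤ 1`, because of the last factor.) -/
def IsSolution (p β : ℝ) (u₁ u₂ : ℝ → ℂ) : Prop :=
  MemH1 u₁ ∧ MemH1 u₂ ∧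
  (∀ φ : ℝ → ℂ, MemH1 φ → energyForm u₁ φ =
    ∫ x, ((‖u₁ x‖ ^ (2 * p) + β * ‖u₂ x‖ ^ (p + 1) * ‖u₁ x‖ ^ (p - 1) : ℝ) : ℂ)
      * u₁ x * conj (φ x)) ∧
  (∀ φ : ℝ → ℂ, MemH1 φ → energyForm u₂ φ =
    ∫ x, ((‖u₂ x‖ ^ (2 * p) + β * ‖u₁ x‖ ^ (p + 1) * ‖u₂ x‖ ^ (p - 1) : ℝ) : ℂ)
      * u₂ x * conj (φ x))

/-- The energy (action) functional `𝓘` whose critical points are the solutions of the system. -/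
def action (p β : ℝ) (u₁ u₂ : ℝ → ℂ) : ℝ :=
  (1 / 2) * (energyNormSq u₁ + energyNormSq u₂)
    - 1 / (2 * p + 2) * ((∫ x, ‖u₁ x‖ ^ (2 * p + 2)) + ∫ x, ‖u₂ x‖ ^ (2 * p + 2))
    - β / (p + 1) * ∫ x, ‖u₁ x * u₂ x‖ ^ (p + 1)

/-- The Nehari set `𝓝` of pairs in `H¹ × H¹` with two nontrivial components such that
`‖uᵢ‖² = ‖uᵢ‖_{2p+2}^{2p+2} + β ‖u₁ u₂‖_{p+1}^{p+1}` for `i = 1, 2`. -/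
def nehari (p β : ℝ) : Set ((ℝ → ℂ) × (ℝ → ℂ)) :=
  {U | MemH1 U.1 ∧ MemH1 U.2 ∧ ¬ U.1 =ᵐ[volume] 0 ∧ ¬ U.2 =ᵐ[volume] 0 ∧
    energyNormSq U.1 =
      (∫ x, ‖U.1 x‖ ^ (2 * p + 2)) + β * ∫ x, ‖U.1 x * U.2 x‖ ^ (p + 1) ∧
    energyNormSq U.2 =
      (∫ x, ‖U.2 x‖ ^ (2 * p + 2)) + β * ∫ x, ‖U.1 x * U.2 x‖ ^ (p + 1)}

/-- Ground state of the system: a solution with two nontrivial components, of least energy among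
all such solutions. -/
def IsGroundState (p β : ℝ) (u₁ u₂ : ℝ → ℂ) : Prop :=
  IsSolution p β u₁ u₂ ∧ ¬ u₁ =ᵐ[volume] 0 ∧ ¬ u₂ =ᵐ[volume] 0 ∧
  ∀ v₁ v₂ : ℝ → ℂ, IsSolution p β v₁ v₂ → ¬ v₁ =ᵐ[volume] 0 → ¬ v₂ =ᵐ[volume] 0 →
    action p β u₁ u₂ ≤ action p β v₁ v₂

/-- `(φ, ψ) ∈ H¹(ℝ, ℝ)²` is a (weak) solution of the system linearized at `(r₁, r₂)`, where
`r₁, r₂` are nonnegative: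
`-½ φ'' + φ = [(2p+1) r₁^(2p) + β p r₁^(p-1) r₂^(p+1)] φ + β (p+1) r₁^p r₂^p ψ` and
`-½ ψ'' + ψ = [(2p+1) r₂^(2p) + β p r₁^(p+1) r₂^(p-1)] ψ + β (p+1) r₁^p r₂^p φ`. -/
def IsLinearizedSolution (p β : ℝ) (r₁ r₂ φ ψ : ℝ → ℝ) : Prop :=
  MemH1 φ ∧ MemH1 ψ ∧
  (∀ η : ℝ → ℝ, MemH1 η → energyFormReal φ η =
    ∫ x, (((2 * p + 1) * r₁ x ^ (2 * p) + β * p * r₁ x ^ (p - 1) * r₂ x ^ (p + 1)) * φ x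
      + β * (p + 1) * r₁ x ^ p * r₂ x ^ p * ψ x) * η x) ∧
  (∀ η : ℝ → ℝ, MemH1 η → energyFormReal ψ η =
    ∫ x, (((2 * p + 1) * r₂ x ^ (2 * p) + β * p * r₁ x ^ (p + 1) * r₂ x ^ (p - 1)) * ψ x
      + β * (p + 1) * r₁ x ^ p * r₂ x ^ p * φ x) * η x)

/-- The ground state `R = (r₁, r₂)` is non-degenerate: `∂ₓ R ≠ 0`, and the solutions of the system
linearized at `R` are exactly the multiples `θ ∂ₓ R`, `θ ∈ ℝ` (as classes modulo null sets). -/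
def IsNondegenerateGroundState (p β : ℝ) (r₁ r₂ : ℝ → ℝ) : Prop :=
  IsGroundState p β (toComplex r₁) (toComplex r₂) ∧
  ¬ (weakDeriv r₁ =ᵐ[volume] 0 ∧ weakDeriv r₂ =ᵐ[volume] 0) ∧
  ∀ φ ψ : ℝ → ℝ, IsLinearizedSolution p β r₁ r₂ φ ψ ↔
    ∃ θ : ℝ, φ =ᵐ[volume] (fun x => θ * weakDeriv r₁ x) ∧
      ψ =ᵐ[volume] (fun x => θ * weakDeriv r₂ x)

end System

end

/-!
The scalar ground state is the soliton `z = (p+1)^(1/(2p)) sech^(1/p)(√2 p x)`.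

*Minimality of `z`.* Let `V(s) = s²/2 - s^(2p+2)/(2p+2)`, so that the scalar action is
`∫ ¼ |u'|² + V(|u|)`. If `max |u|` is the positive zero `m` of `V`, then `V(|u|) ≥ 0`, and
`¼ |u'|² + V(|u|) ≥ √V(|u|) |u'|` bounds the action below by `2 ∫₀^m √V`
(`two_mul_sqrtPotentialPrimitive_le`). The soliton satisfies `¼ z'² = V(z)` and attains this value
(`integral_energy_soliton`). As every nonzero `u ∈ H¹` has a multiple with maximum `m`, optimizing
over multiples gives the sharp Gagliardo–Nirenberg inequality `sharp_inequality`.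

*Uniqueness of `z`.* For a positive even `H¹` solution `y` the first integral vanishes, which turns
the equation into the linear equation `w'' = 2p² w` for `w = y^(-p)`
(`eq_soliton_of_positive_even`).

*The Nehari set.* By the sharp inequality and the Cauchy–Schwarz inequality, the quotients
`x = ‖u₁‖²/‖z‖²`, `y = ‖u₂‖²/‖z‖²` of a pair in the Nehari set satisfy
`x ≤ x^(p+1) + β (xy)^((p+1)/2)` and the same with `x` and `y` exchanged. Writing
`x = m e^τ`, `y = m e^(-τ)`, these read `1 ≤ m^p (e^(±pτ) + β e^(∓τ))`, and one of the two factors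
is at most `(1+β) cosh^p τ` (`min_constraint_le`). Hence `x + y ≥ 2 (1+β)^(-1/p)`, with equality for
`Z = a (z, z)`. On the Nehari set, as for solutions, the action is
`p/(2p+2) (‖u₁‖² + ‖u₂‖²)`, so that `Z` is a minimizer. A solution with one vanishing component has
at least the action of `z`, and `2^p ≤ 1 + β` says that this is no less than the action of `Z`.

*Non-degeneracy.* The sum and the difference of the components of a solution of the linearized
system solve `-½ g'' + g = μ z^(2p) g` with `μ = 2p+1` and `μ = (2p+1-β)/(1+β)`, which is less than
`2p+1`, and equals `1` only if `p = β`. Let `W = g' z - g z'`. Up to a constant, `W / z^(2p+2)` is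
the derivative of `g/z` with respect to `tanh(√2 p x)`; it satisfies
`(z^(2p+2) K')' = 2 (2p+1-μ) z^(4p+2) K`. Multiplying by `K` and integrating shows that `K` is
constant, and zero if `μ < 2p+1` (`solitonWronskian_identity`); the boundary terms vanish because
`W / z^(2p+1) → 0` at infinity by l'Hôpital's rule. This leaves the multiples of `z'` for the sum
and only zero for the difference.
-/

open Set Filter Topology

/-! ### Weak derivatives and indefinite integrals -/

section WeakDerivatives

variable {E : Type*} [NormedAddCommGroup E] [NormedSpace ℝ E]

/-- `U` is an indefinite integral of the locally integrable function `g`; that is, `U` is locally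
absolutely continuous with derivative `g`. -/
def IsAntideriv (U g : ℝ → E) : Prop :=
  LocallyIntegrable g volume ∧ ∀ x y, U y - U x = ∫ t in x..y, g t

lemma MeasureTheory.LocallyIntegrable.intervalIntegrable_real {F : Type*} [NormedAddCommGroup F]
    {g : ℝ → F} (hg : LocallyIntegrable g volume)
    (a b : ℝ) : IntervalIntegrable g volume a b :=
  intervalIntegrable_iff.mpr <|
    (hg.integrableOn_isCompact isCompact_uIcc).mono_set uIoc_subset_uIcc

lemma MeasureTheory.LocallyIntegrable.norm_real {F : Type*} [NormedAddCommGroup F] {g : ℝ → F}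
    (hg : LocallyIntegrable g volume) : LocallyIntegrable (fun x => ‖g x‖) volume := fun x => by
  obtain ⟨s, hs, hi⟩ := hg x
  exact ⟨s, hs, hi.norm⟩

lemma isAntideriv_integral {g : ℝ → E} (hg : LocallyIntegrable g volume) (c : E) (a : ℝ) :
    IsAntideriv (fun x => c + ∫ t in a..x, g t) g := by
  refine ⟨hg, fun x y => ?_⟩
  rw [add_sub_add_left_eq_sub]
  exact intervalIntegral.integral_interval_sub_left (hg.intervalIntegrable_real _ _)
    (hg.intervalIntegrable_real _ _)

lemma IsAntideriv.norm_sub_le {U g : ℝ → E} (h : IsAntideriv U g) (x y : ℝ) :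
    ‖U y - U x‖ ≤ |∫ t in x..y, ‖g t‖| := by
  rw [h.2 x y]
  exact intervalIntegral.norm_integral_le_abs_integral_norm

lemma AbsolutelyContinuousOnInterval.of_dist_le {X Y : Type*} [PseudoMetricSpace X]
    [PseudoMetricSpace Y] {f : ℝ → X} {g : ℝ → Y} {a b : ℝ}
    (hg : AbsolutelyContinuousOnInterval g a b) (h : ∀ x y, dist (f x) (f y) ≤ dist (g x) (g y)) :
    AbsolutelyContinuousOnInterval f a b := by
  rw [absolutelyContinuousOnInterval_iff] at hg ⊢
  intro ε hε
  obtain ⟨δ, hδ, H⟩ := hg ε hε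
  exact ⟨δ, hδ, fun I hI hs => (Finset.sum_le_sum fun i _ => h _ _).trans_lt (H I hI hs)⟩

lemma IsAntideriv.absolutelyContinuous {U g : ℝ → E} (h : IsAntideriv U g) (a b : ℝ) :
    AbsolutelyContinuousOnInterval U a b := by
  have hN := (h.1.norm_real.intervalIntegrable_real a b).absolutelyContinuousOnInterval_intervalIntegral
    (c := a) (by simp)
  refine hN.of_dist_le fun x y => ?_
  rw [dist_comm, dist_eq_norm, dist_comm, Real.dist_eq, intervalIntegral.integral_interval_sub_left
    (h.1.norm_real.intervalIntegrable_real _ _) (h.1.norm_real.intervalIntegrable_real _ _)]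
  exact h.norm_sub_le x y

lemma IsAntideriv.continuous {U g : ℝ → E} (h : IsAntideriv U g) : Continuous U := by
  rw [continuous_iff_continuousAt]
  intro x
  have := (h.absolutelyContinuous (x - 1) (x + 1)).continuousOn
  refine this.continuousAt ?_
  rw [uIcc_of_le (by linarith)]
  exact Icc_mem_nhds (by linarith) (by linarith)

lemma IsAntideriv.hasDerivAt_of_continuous [CompleteSpace E] {U g : ℝ → E} (h : IsAntideriv U g)
    (hg : Continuous g) (x : ℝ) : HasDerivAt U (g x) x := by
  have h1 : U = fun y => U x + ∫ t in x..y, g t := by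
    ext y; rw [← h.2 x y]; abel
  have h2 := (hg.integral_hasStrictDerivAt x x).hasDerivAt.const_add (U x)
  rw [h1]
  exact h2

lemma IsAntideriv.congr_right {U g g' : ℝ → E} (h : IsAntideriv U g) (hg : g =ᵐ[volume] g') :
    IsAntideriv U g' := by
  refine ⟨h.1.congr hg, fun x y => ?_⟩
  rw [h.2 x y]
  exact intervalIntegral.integral_congr_ae (hg.mono fun t ht _ => ht)

lemma isAntideriv_of_hasDerivAt [CompleteSpace E] {U g : ℝ → E} (h : ∀ x, HasDerivAt U (g x) x)
    (hg : Continuous g) : IsAntideriv U g :=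
  ⟨hg.locallyIntegrable, fun x y =>
    (intervalIntegral.integral_eq_sub_of_hasDerivAt (fun t _ => h t) (hg.intervalIntegrable x y)).symm⟩

lemma HasWeakDeriv.congr {u u' g g' : ℝ → E} (h : HasWeakDeriv u g) (hu : u =ᵐ[volume] u')
    (hg : g =ᵐ[volume] g') : HasWeakDeriv u' g' := by
  refine ⟨h.1.congr hu, h.2.1.congr hg, fun η h1 h2 => ?_⟩
  have e1 : ∫ x, deriv η x • u' x = ∫ x, deriv η x • u x :=
    integral_congr_ae (hu.mono fun x hx => by simp only [hx])
  have e2 : ∫ x, η x • g' x = ∫ x, η x • g x :=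
    integral_congr_ae (hg.mono fun x hx => by simp only [hx])
  rw [e1, e2, h.2.2 η h1 h2]

lemma HasWeakDeriv.add {u v g k : ℝ → E} (h : HasWeakDeriv u g) (h' : HasWeakDeriv v k) :
    HasWeakDeriv (fun x => u x + v x) (fun x => g x + k x) := by
  refine ⟨h.1.add h'.1, h.2.1.add h'.2.1, fun η h1 h2 => ?_⟩
  have hcd : Continuous (deriv η) := h1.continuous_deriv (by simp)
  simp only [smul_add]
  rw [integral_add (h.1.integrable_smul_left_of_hasCompactSupport hcd h2.deriv)
    (h'.1.integrable_smul_left_of_hasCompactSupport hcd h2.deriv),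
    integral_add (h.2.1.integrable_smul_left_of_hasCompactSupport h1.continuous h2)
    (h'.2.1.integrable_smul_left_of_hasCompactSupport h1.continuous h2),
    h.2.2 η h1 h2, h'.2.2 η h1 h2, neg_add]

lemma MeasureTheory.LocallyIntegrable.clm_comp {F : Type*} [NormedAddCommGroup F] [NormedSpace ℝ F]
    {u : ℝ → E} (h : LocallyIntegrable u volume) (L : E →L[ℝ] F) :
    LocallyIntegrable (fun x => L (u x)) volume := fun x => by
  obtain ⟨s, hs, hi⟩ := h x
  exact ⟨s, hs, L.integrable_comp hi⟩

lemma weakDeriv_spec {u : ℝ → E} (h : MemH1 u) :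
    MemLp (weakDeriv u) 2 volume ∧ HasWeakDeriv u (weakDeriv u) := by
  rw [weakDeriv, dif_pos h.2]
  exact h.2.choose_spec

variable [CompleteSpace E]

lemma IsAntideriv.ae_hasDerivAt {U g : ℝ → E} (h : IsAntideriv U g) :
    ∀ᵐ x, HasDerivAt U (g x) x := by
  filter_upwards [LocallyIntegrable.ae_hasDerivAt_integral h.1] with x hx
  have h1 : U = fun y => U 0 + ∫ t in (0 : ℝ)..y, g t := by
    ext y; rw [← h.2 0 y]; abel
  rw [h1]
  exact (hx 0).const_add (U 0)

/-- Integration by parts of an absolutely continuous function against a `C¹` function. -/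
lemma IsAntideriv.integral_smul {U g : ℝ → E} (h : IsAntideriv U g) {F F' : ℝ → ℝ}
    (hF : ∀ x, HasDerivAt F (F' x) x) (hF' : Continuous F') (a b : ℝ) :
    ∫ x in a..b, (F' x • U x + F x • g x) = F b • U b - F a • U a := by
  have hFc : Continuous F := continuous_iff_continuousAt.2 fun x => (hF x).continuousAt
  have hloc : LocallyIntegrable (fun x => F' x • U x + F x • g x) volume := by
    refine LocallyIntegrable.add (hF'.smul h.continuous).locallyIntegrable ?_
    rw [← locallyIntegrableOn_univ]
    exact (locallyIntegrableOn_univ.2 h.1).continuousOn_smul isOpen_univ.isLocallyClosed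
      hFc.continuousOn
  have hI := isAntideriv_integral hloc 0 a
  have hac : AbsolutelyContinuousOnInterval
      ((fun x => F x • U x) - fun x => 0 + ∫ t in a..x, (F' t • U t + F t • g t)) a b :=
    (AbsolutelyContinuousOnInterval.fun_smul
      ((isAntideriv_of_hasDerivAt hF hF').absolutelyContinuous a b)
      (h.absolutelyContinuous a b)).sub (hI.absolutelyContinuous a b)
  obtain ⟨C, hC⟩ := hac.const_of_ae_hasDerivAt_zero (by
    filter_upwards [h.ae_hasDerivAt, hI.ae_hasDerivAt] with x h1 h2 _
    have := ((hF x).fun_smul h1).sub h2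
    rwa [add_comm (F' x • U x), sub_self] at this)
  have h1 := hC a (by simp)
  have h2 := hC b (by simp)
  simp only [Pi.sub_apply, intervalIntegral.integral_same, sub_zero, zero_add] at h1 h2
  rw [h1, ← h2]
  abel

lemma IsAntideriv.hasWeakDeriv {U g : ℝ → E} (h : IsAntideriv U g) : HasWeakDeriv U g := by
  refine ⟨h.continuous.locallyIntegrable, h.1, fun η hη hs => ?_⟩
  have hd : ∀ x, HasDerivAt η (deriv η x) x := fun x =>
    (hη.differentiable (by simp) x).hasDerivAt
  have hcd : Continuous (deriv η) := hη.continuous_deriv (by simp)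
  have i1 : Integrable (fun x => deriv η x • U x) :=
    h.continuous.locallyIntegrable.integrable_smul_left_of_hasCompactSupport hcd hs.deriv
  have i2 : Integrable (fun x => η x • g x) :=
    h.1.integrable_smul_left_of_hasCompactSupport hη.continuous hs
  rw [eq_neg_iff_add_eq_zero, ← integral_add i1 i2]
  have lim := intervalIntegral_tendsto_integral (i1.add i2) tendsto_neg_atTop_atBot tendsto_id
  refine tendsto_nhds_unique lim ?_
  obtain ⟨R, hR⟩ := hs.isCompact.isBounded.subset_closedBall 0
  refine tendsto_const_nhds.congr' ?_
  filter_upwards [eventually_gt_atTop R, eventually_gt_atTop 0] with x hx hx0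
  have hz : ∀ y, R < |y| → η y = 0 := fun y hy => by
    by_contra hne
    have := hR (subset_tsupport η hne)
    rw [Metric.mem_closedBall, dist_zero_right, Real.norm_eq_abs] at this
    linarith
  have := h.integral_smul hd hcd (-x) x
  rw [hz x (by rwa [abs_of_pos hx0]), hz (-x) (by rwa [abs_neg, abs_of_pos hx0])] at this
  simpa using this.symm

lemma HasWeakDeriv.unique {u g g' : ℝ → E} (h : HasWeakDeriv u g) (h' : HasWeakDeriv u g') :
    g =ᵐ[volume] g' := by
  refine ae_eq_of_integral_contDiff_smul_eq h.2.1 h'.2.1 fun η h1 h2 => ?_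
  have e1 := h.2.2 η h1 h2
  have e2 := h'.2.2 η h1 h2
  rw [e1] at e2
  exact neg_injective e2

/-- Weak derivatives commute with continuous linear maps. -/
lemma HasWeakDeriv.clm_comp {F : Type*} [NormedAddCommGroup F] [NormedSpace ℝ F] [CompleteSpace F]
    {u g : ℝ → E} (h : HasWeakDeriv u g) (L : E →L[ℝ] F) :
    HasWeakDeriv (fun x => L (u x)) (fun x => L (g x)) := by
  refine ⟨h.1.clm_comp L, h.2.1.clm_comp L, fun η h1 h2 => ?_⟩
  have hcd : Continuous (deriv η) := h1.continuous_deriv (by simp)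
  simp only [← map_smul]
  rw [L.integral_comp_comm (h.1.integrable_smul_left_of_hasCompactSupport hcd h2.deriv),
    L.integral_comp_comm (h.2.1.integrable_smul_left_of_hasCompactSupport h1.continuous h2),
    h.2.2 η h1 h2, map_neg]

/-- A test function with vanishing integral is the derivative of a test function. -/
lemma exists_deriv_eq_of_integral_eq_zero {ζ : ℝ → ℝ} (hζ : ContDiff ℝ ∞ ζ)
    (hs : HasCompactSupport ζ) (h0 : ∫ x, ζ x = 0) :
    ∃ η : ℝ → ℝ, ContDiff ℝ ∞ η ∧ HasCompactSupport η ∧ deriv η = ζ := by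
  obtain ⟨R, hR⟩ := hs.isCompact.isBounded.subset_closedBall 0
  have hz : ∀ y, R < |y| → ζ y = 0 := fun y hy => by
    by_contra hne
    have := hR (subset_tsupport ζ hne)
    rw [Metric.mem_closedBall, dist_zero_right, Real.norm_eq_abs] at this
    linarith
  have hint : Integrable ζ := hζ.continuous.integrable_of_hasCompactSupport hs
  have hd : ∀ x, HasDerivAt (fun x => ∫ t in Iic x, ζ t) (ζ x) x := fun x => by
    have := ((hζ.continuous.integral_hasStrictDerivAt 0 x).hasDerivAt).const_add (∫ t in Iic 0, ζ t)
    refine this.congr_of_eventuallyEq (Eventually.of_forall fun y => ?_)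
    have := intervalIntegral.integral_Iic_sub_Iic (a := 0) (b := y) hint.integrableOn hint.integrableOn
    simp only
    rw [← this]
    ring
  have hde : deriv (fun x => ∫ t in Iic x, ζ t) = ζ := funext fun x => (hd x).deriv
  refine ⟨fun x => ∫ t in Iic x, ζ t, ?_, ?_, hde⟩
  · rw [contDiff_infty_iff_deriv]
    exact ⟨fun x => (hd x).differentiableAt, by rwa [hde]⟩
  · refine HasCompactSupport.intro (isCompact_closedBall (0 : ℝ) R) fun x hx => ?_
    have hx : R < |x| := by simpa using hx
    rcases le_or_gt 0 x with h | h
    · rw [abs_of_nonneg h] at hx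
      have h3 := integral_add_compl (s := Iic x) (f := ζ) measurableSet_Iic hint
      rw [h0, compl_Iic, setIntegral_eq_zero_of_forall_eq_zero (t := Ioi x) (fun y hy => hz y
        (lt_of_lt_of_le (hx.trans hy) (le_abs_self y)))] at h3
      simpa using h3
    · rw [abs_of_neg h] at hx
      refine setIntegral_eq_zero_of_forall_eq_zero fun y hy => hz y ?_
      rw [abs_of_neg (lt_of_le_of_lt hy h)]
      have : y ≤ x := hy
      linarith

/-- **Du Bois-Reymond lemma**: a function with vanishing weak derivative is constant. -/
lemma HasWeakDeriv.ae_eq_const {w : ℝ → E} (h : HasWeakDeriv w 0) :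
    ∃ c : E, w =ᵐ[volume] fun _ => c := by
  let ρ : ContDiffBump (0 : ℝ) := ⟨1, 2, by norm_num, by norm_num⟩
  set r : ℝ → ℝ := ρ.normed volume
  have hr : ContDiff ℝ ∞ r := ρ.contDiff_normed
  have hrs : HasCompactSupport r := ρ.hasCompactSupport_normed
  have hr1 : ∫ x, r x = 1 := ρ.integral_normed
  refine ⟨∫ x, r x • w x, ?_⟩
  refine ae_eq_of_integral_contDiff_smul_eq h.1 continuous_const.locallyIntegrable
    fun φ hφ hφs => ?_
  have hφi : Integrable φ := hφ.continuous.integrable_of_hasCompactSupport hφs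
  have hri : Integrable r := hr.continuous.integrable_of_hasCompactSupport hrs
  obtain ⟨η, h1, h2, h3⟩ := exists_deriv_eq_of_integral_eq_zero
    (ζ := fun x => φ x - (∫ y, φ y) * r x) (hφ.sub (contDiff_const.mul hr))
    (hφs.sub (hrs.mul_left)) (by
      rw [integral_sub hφi (hri.const_mul _), integral_const_mul, hr1]; ring)
  have h4 := h.2.2 η h1 h2
  rw [h3] at h4
  simp only [sub_smul, Pi.zero_apply, smul_zero, integral_zero, neg_zero, mul_smul] at h4
  erw [integral_sub (h.1.integrable_smul_left_of_hasCompactSupport hφ.continuous hφs)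
    ((h.1.integrable_smul_left_of_hasCompactSupport hr.continuous hrs).smul (∫ y, φ y)),
    integral_smul, sub_eq_zero] at h4
  rw [h4, integral_smul_const]

/-- A function with a weak derivative agrees almost everywhere with an indefinite integral of it. -/
lemma HasWeakDeriv.exists_isAntideriv {u g : ℝ → E} (h : HasWeakDeriv u g) :
    ∃ U : ℝ → E, u =ᵐ[volume] U ∧ IsAntideriv U g := by
  have h1 := isAntideriv_integral h.2.1 0 0
  have h2 := h.add (h1.hasWeakDeriv.clm_comp (-ContinuousLinearMap.id ℝ E))
  obtain ⟨c, hc⟩ := HasWeakDeriv.ae_eq_const (h2.congr (g' := 0) (EventuallyEq.refl _ _)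
    (Eventually.of_forall fun x => by simp))
  refine ⟨_, ?_, isAntideriv_integral h.2.1 c 0⟩
  filter_upwards [hc] with x hx
  simp at hx
  rw [← hx]
  abel

lemma HasWeakDeriv.weakDeriv_ae_eq {u g : ℝ → E} (h : HasWeakDeriv u g) (hg : MemLp g 2 volume) :
    weakDeriv u =ᵐ[volume] g := by
  have : ∃ g : ℝ → E, MemLp g 2 volume ∧ HasWeakDeriv u g := ⟨g, hg, h⟩
  rw [weakDeriv, dif_pos this]
  exact this.choose_spec.2.unique h

end WeakDerivatives

/-! ### Functions in `H¹(ℝ)` -/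

section SobolevFunctions

variable {E : Type*} [NormedAddCommGroup E] [NormedSpace ℝ E]

lemma isAntideriv_of_absolutelyContinuous {f f' : ℝ → ℝ}
    (hf : ∀ a b, AbsolutelyContinuousOnInterval f a b) (hf' : LocallyIntegrable f' volume)
    (hd : ∀ᵐ x, HasDerivAt f (f' x) x) : IsAntideriv f f' := by
  refine ⟨hf', fun x y => ?_⟩
  rw [← (hf x y).integral_deriv_eq_sub]
  exact intervalIntegral.integral_congr_ae (hd.mono fun t ht _ => ht.deriv)

/-- If `U` is absolutely continuous with derivative `g`, then `‖U‖` is absolutely continuous and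
`|‖U‖'| ≤ ‖g‖` almost everywhere. -/
lemma IsAntideriv.norm [CompleteSpace E] {U g : ℝ → E} (h : IsAntideriv U g) :
    IsAntideriv (fun x => ‖U x‖) (deriv fun x => ‖U x‖) ∧
      (∀ᵐ x, HasDerivAt (fun x => ‖U x‖) (deriv (fun x => ‖U x‖) x) x) ∧
      ∀ᵐ x, |deriv (fun x => ‖U x‖) x| ≤ ‖g x‖ := by
  have hac : ∀ a b, AbsolutelyContinuousOnInterval (fun x => ‖U x‖) a b := fun a b =>
    (h.absolutelyContinuous a b).of_dist_le fun x y => by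
      rw [Real.dist_eq, dist_eq_norm]; exact abs_norm_sub_norm_le _ _
  have hd : ∀ᵐ x, DifferentiableAt ℝ (fun x => ‖U x‖) x := by
    have : ∀ n : ℕ, ∀ᵐ x, x ∈ uIcc (-n : ℝ) n → DifferentiableAt ℝ (fun x => ‖U x‖) x :=
      fun n => (hac _ _).ae_differentiableAt
    filter_upwards [ae_all_iff.2 this] with x hx
    obtain ⟨n, hn⟩ := exists_nat_ge |x|
    refine hx n ?_
    rw [uIcc_of_le (by linarith [n.cast_nonneg (α := ℝ)])]
    exact abs_le.1 hn
  have hb : ∀ᵐ x, |deriv (fun x => ‖U x‖) x| ≤ ‖g x‖ := by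
    filter_upwards [hd, h.ae_hasDerivAt] with x h1 h2
    have t1 := (hasDerivAt_iff_tendsto_slope.1 h1.hasDerivAt).abs
    have t2 := (hasDerivAt_iff_tendsto_slope.1 h2).norm
    refine le_of_tendsto_of_tendsto' t1 t2 fun y => ?_
    simp only [slope, vsub_eq_sub, smul_eq_mul, abs_mul, norm_smul, Real.norm_eq_abs]
    exact mul_le_mul_of_nonneg_left (abs_norm_sub_norm_le _ _) (abs_nonneg _)
  have hl : LocallyIntegrable (deriv fun x => ‖U x‖) volume := by
    intro x
    obtain ⟨s, hs, hi⟩ := h.1 x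
    exact ⟨s, hs, hi.norm.mono' (measurable_deriv _).aestronglyMeasurable
      (ae_restrict_of_ae hb)⟩
  have hd' := hd.mono fun x hx => hx.hasDerivAt
  exact ⟨isAntideriv_of_absolutelyContinuous hac hl hd', hd', hb⟩

lemma IsAntideriv.tendsto_atTop [CompleteSpace E] {f f' : ℝ → E} (h : IsAntideriv f f')
    (hf : Integrable f) (hf' : Integrable f') : Tendsto f atTop (𝓝 0) := by
  have h1 := intervalIntegral_tendsto_integral_Ioi 0 (hf'.integrableOn (s := Ioi 0)) tendsto_id
  have h2 : Tendsto f atTop (𝓝 (f 0 + ∫ t in Ioi 0, f' t)) :=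
    (h1.const_add (f 0)).congr fun x => by rw [id, ← h.2 0 x]; abel
  have h3 : IntegrableAtFilter f atTop volume := ⟨univ, univ_mem, hf.integrableOn⟩
  have h4 := IntegrableAtFilter.eq_zero_of_tendsto h3 (by
    intro s hs
    obtain ⟨a, ha⟩ := mem_atTop_sets.1 hs
    exact top_unique ((Real.volume_Ici (a := a)).symm.le.trans (measure_mono ha))) h2
  rwa [h4] at h2

lemma IsAntideriv.tendsto_atBot [CompleteSpace E] {f f' : ℝ → E} (h : IsAntideriv f f')
    (hf : Integrable f) (hf' : Integrable f') : Tendsto f atBot (𝓝 0) := by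
  have h1 := intervalIntegral_tendsto_integral_Iic 0 (hf'.integrableOn (s := Iic 0)) tendsto_id
  have h2 : Tendsto f atBot (𝓝 (f 0 - ∫ t in Iic 0, f' t)) :=
    (h1.const_sub (f 0)).congr fun x => by rw [id, ← h.2 x 0]; abel
  have h3 : IntegrableAtFilter f atBot volume := ⟨univ, univ_mem, hf.integrableOn⟩
  have h4 := IntegrableAtFilter.eq_zero_of_tendsto h3 (by
    intro s hs
    obtain ⟨a, ha⟩ := mem_atBot_sets.1 hs
    exact top_unique ((Real.volume_Iic (a := a)).symm.le.trans (measure_mono ha))) h2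
  rwa [h4] at h2

lemma IsAntideriv.integral_eq_zero [CompleteSpace E] {f f' : ℝ → E} (h : IsAntideriv f f')
    (hf : Integrable f) (hf' : Integrable f') : ∫ x, f' x = 0 := by
  have h1 := intervalIntegral_tendsto_integral hf' tendsto_neg_atTop_atBot tendsto_id
  have h2 := (h.tendsto_atTop hf hf').sub
    ((h.tendsto_atBot hf hf').comp tendsto_neg_atTop_atBot)
  rw [sub_zero] at h2
  exact tendsto_nhds_unique h1 (h2.congr fun x => by simp [h.2])

lemma integrable_smul_of_memLp_two {F : ℝ → ℝ} {g : ℝ → E} (hF : MemLp F 2 volume)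
    (hg : MemLp g 2 volume) : Integrable (fun x => F x • g x) :=
  memLp_one_iff_integrable.1 (hg.smul hF)

lemma integrable_norm_sq_of_memLp_two {F : Type*} [NormedAddCommGroup F] {g : ℝ → F}
    (hg : MemLp g 2 volume) :
    Integrable (fun x => ‖g x‖ ^ 2) := (memLp_two_iff_integrable_sq_norm hg.1).1 hg

lemma IsAntideriv.tendsto_zero_of_memLp_two [CompleteSpace E] {U g : ℝ → E} (h : IsAntideriv U g)
    (hU : MemLp U 2 volume) (hg : MemLp g 2 volume) :
    Tendsto U atTop (𝓝 0) ∧ Tendsto U atBot (𝓝 0) := by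
  obtain ⟨h1, h2, h3⟩ := h.norm
  set n : ℝ → ℝ := fun x => ‖U x‖
  have hn : MemLp n 2 volume := hU.norm
  have hn' : MemLp (deriv n) 2 volume :=
    hg.mono (measurable_deriv _).aestronglyMeasurable (by simpa using h3)
  have i1 : Integrable (fun x => n x * n x) := integrable_smul_of_memLp_two hn hn
  have i2 : Integrable (fun x => deriv n x * n x + n x * deriv n x) :=
    (integrable_smul_of_memLp_two hn' hn).add (integrable_smul_of_memLp_two hn hn')
  have h4 : IsAntideriv (fun x => n x * n x) (fun x => deriv n x * n x + n x * deriv n x) :=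
    isAntideriv_of_absolutelyContinuous
      (fun a b => (h1.absolutelyContinuous a b).fun_mul (h1.absolutelyContinuous a b))
      i2.locallyIntegrable (h2.mono fun x hx => hx.mul hx)
  have key : ∀ l : Filter ℝ, Tendsto (fun x => n x * n x) l (𝓝 0) → Tendsto U l (𝓝 0) := by
    intro l hl
    rw [tendsto_zero_iff_norm_tendsto_zero]
    have := hl.sqrt
    simpa [n] using this
  exact ⟨key _ (h4.tendsto_atTop i1 i2), key _ (h4.tendsto_atBot i1 i2)⟩

/-- The continuous representative of an `H¹` function. -/
lemma MemH1.exists_rep [CompleteSpace E] {u : ℝ → E} (h : MemH1 u) :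
    ∃ U : ℝ → E, u =ᵐ[volume] U ∧ IsAntideriv U (weakDeriv u) ∧ MemLp U 2 volume ∧
      Tendsto U atTop (𝓝 0) ∧ Tendsto U atBot (𝓝 0) := by
  obtain ⟨h1, h2⟩ := weakDeriv_spec h
  obtain ⟨U, hU, hA⟩ := h2.exists_isAntideriv
  have h3 : MemLp U 2 volume := h.1.ae_eq hU
  exact ⟨U, hU, hA, h3, hA.tendsto_zero_of_memLp_two h3 h1⟩

/-- A continuous function vanishing at infinity attains the maximum of its norm. -/
lemma exists_forall_norm_le_of_tendsto_zero {F : Type*} [NormedAddCommGroup F] {U : ℝ → F}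
    (hc : Continuous U)
    (h1 : Tendsto U atTop (𝓝 0)) (h2 : Tendsto U atBot (𝓝 0)) :
    ∃ x₀, ∀ x, ‖U x‖ ≤ ‖U x₀‖ := by
  by_cases h0 : ∃ x, U x ≠ 0
  · obtain ⟨y, hy⟩ := h0
    have hc' : Continuous fun x => ‖U x‖ := hc.norm
    refine hc'.exists_forall_ge' y ?_
    rw [cocompact_eq_atBot_atTop, eventually_sup]
    have hpos := norm_pos_iff.2 hy
    constructor
    · have := (tendsto_zero_iff_norm_tendsto_zero.1 h2).eventually (gt_mem_nhds hpos)
      exact this.mono fun x hx => hx.le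
    · have := (tendsto_zero_iff_norm_tendsto_zero.1 h1).eventually (gt_mem_nhds hpos)
      exact this.mono fun x hx => hx.le
  · push Not at h0
    exact ⟨0, fun x => by simp [h0]⟩

lemma MemH1.exists_bound [CompleteSpace E] {u : ℝ → E} (h : MemH1 u) :
    ∃ M : ℝ, ∀ᵐ x, ‖u x‖ ≤ M := by
  obtain ⟨U, hU, hA, -, h1, h2⟩ := h.exists_rep
  obtain ⟨x₀, hx₀⟩ := exists_forall_norm_le_of_tendsto_zero hA.continuous h1 h2
  exact ⟨‖U x₀‖, hU.mono fun x hx => by rw [hx]; exact hx₀ x⟩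

/-- `H¹ ⊆ Lˢ` for `s ≥ 2`. -/
lemma MemH1.integrable_norm_rpow [CompleteSpace E] {u : ℝ → E} (h : MemH1 u) {s : ℝ} (hs : 2 ≤ s) :
    Integrable (fun x => ‖u x‖ ^ s) := by
  obtain ⟨M, hM⟩ := h.exists_bound
  have hi := (integrable_norm_sq_of_memLp_two h.1).const_mul (M ^ (s - 2))
  refine hi.mono' (h.1.1.norm.aemeasurable.pow_const s).aestronglyMeasurable ?_
  filter_upwards [hM] with x hx
  rw [Real.norm_of_nonneg (by positivity)]
  rcases (norm_nonneg (u x)).eq_or_lt with h0 | h0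
  · rw [← h0, Real.zero_rpow (by linarith)]
    simp
  · calc ‖u x‖ ^ s = ‖u x‖ ^ (s - 2) * ‖u x‖ ^ 2 := by
          rw [← Real.rpow_natCast, ← Real.rpow_add h0]; norm_num
      _ ≤ _ := by gcongr

/-- Integration by parts of an `H¹` function against a square integrable `C¹` function. -/
lemma MemH1.integral_smul_weakDeriv [CompleteSpace E] {φ : ℝ → E} (hφ : MemH1 φ) {F F' : ℝ → ℝ}
    (hd : ∀ x, HasDerivAt F (F' x) x) (hc : Continuous F') (hF : MemLp F 2 volume)
    (hF' : MemLp F' 2 volume) : ∫ x, F x • weakDeriv φ x = -∫ x, F' x • φ x := by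
  obtain ⟨U, hU, hA, hU2, -, -⟩ := hφ.exists_rep
  have hg := (weakDeriv_spec hφ).1
  have e : ∫ x, F' x • φ x = ∫ x, F' x • U x :=
    integral_congr_ae (hU.mono fun x hx => by simp only [hx])
  have i1 := integrable_smul_of_memLp_two hF' hU2
  have i2 := integrable_smul_of_memLp_two hF hg
  rw [e, eq_neg_iff_add_eq_zero, add_comm, ← integral_add i1 i2]
  have hant : IsAntideriv (fun x => F x • U x) (fun x => F' x • U x + F x • weakDeriv φ x) :=
    ⟨(i1.add i2).locallyIntegrable, fun x y => (hA.integral_smul hd hc x y).symm⟩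
  exact hant.integral_eq_zero (integrable_smul_of_memLp_two hF hU2) (i1.add i2)

lemma memH1_of_hasDerivAt [CompleteSpace E] {f f' : ℝ → E} (hd : ∀ x, HasDerivAt f (f' x) x)
    (hc : Continuous f') (hf : MemLp f 2 volume) (hf' : MemLp f' 2 volume) :
    MemH1 f ∧ weakDeriv f =ᵐ[volume] f' := by
  have h := (isAntideriv_of_hasDerivAt hd hc).hasWeakDeriv
  exact ⟨⟨hf, f', hf', h⟩, h.weakDeriv_ae_eq hf'⟩

lemma MemH1.congr_ae {u v : ℝ → E} (h : MemH1 u) (huv : u =ᵐ[volume] v) : MemH1 v := by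
  obtain ⟨h1, g, h2, h3⟩ := h
  exact ⟨h1.ae_eq huv, g, h2, h3.congr huv (EventuallyEq.refl _ _)⟩

lemma MemH1.weakDeriv_congr_ae [CompleteSpace E] {u v : ℝ → E} (h : MemH1 u)
    (huv : u =ᵐ[volume] v) : weakDeriv v =ᵐ[volume] weakDeriv u :=
  ((weakDeriv_spec h).2.congr huv (EventuallyEq.refl _ _)).weakDeriv_ae_eq (weakDeriv_spec h).1

lemma memLp_toComplex {r : ℝ → ℝ} (h : MemLp r 2 volume) : MemLp (toComplex r) 2 volume :=
  h.ofReal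

lemma energyForm_self (u : ℝ → ℂ) : energyForm u u = energyNormSq u := by
  have : ∀ w : ℝ → ℂ, ∫ x, w x * conj (w x) = ((∫ x, ‖w x‖ ^ 2 : ℝ) : ℂ) := fun w => by
    rw [← integral_complex_ofReal]
    refine integral_congr_ae (Eventually.of_forall fun x => ?_)
    simp only [Complex.mul_conj, Complex.normSq_eq_norm_sq]
  rw [energyForm, energyNormSq, this, this]
  push_cast
  ring

/-- For a classical function `r` the sesquilinear form of `-½ ∂ₓₓ + 1` is the `L²` pairing with
`r - ½ r''`. -/
lemma energyForm_toComplex_eq {r r₁ r₂ : ℝ → ℝ} (hd : ∀ x, HasDerivAt r (r₁ x) x)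
    (hd₁ : ∀ x, HasDerivAt r₁ (r₂ x) x) (hc : Continuous r₂) (hr : MemLp r 2 volume)
    (hr₁ : MemLp r₁ 2 volume) (hr₂ : MemLp r₂ 2 volume) {φ : ℝ → ℂ} (hφ : MemH1 φ) :
    energyForm (toComplex r) φ = ∫ x, ((r x - 1 / 2 * r₂ x : ℝ) : ℂ) * conj (φ x) := by
  have hc₁ : Continuous r₁ := continuous_iff_continuousAt.2 fun x => (hd₁ x).continuousAt
  have hw : weakDeriv (toComplex r) =ᵐ[volume] toComplex r₁ :=
    (memH1_of_hasDerivAt (fun x => (hd x).ofReal_comp) (Complex.continuous_ofReal.comp hc₁)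
      (memLp_toComplex hr) (memLp_toComplex hr₁)).2
  have e1 : ∫ x, weakDeriv (toComplex r) x * conj (weakDeriv φ x)
      = conj (∫ x, r₁ x • weakDeriv φ x) := by
    rw [← integral_conj]
    refine integral_congr_ae (hw.mono fun x hx => ?_)
    simp [hx, toComplex]
  have e2 : ∫ x, toComplex r x * conj (φ x) = conj (∫ x, r x • φ x) := by
    rw [← integral_conj]
    refine integral_congr_ae (Eventually.of_forall fun x => ?_)
    simp [toComplex]
  have e3 : ∫ x, ((r x - 1 / 2 * r₂ x : ℝ) : ℂ) * conj (φ x)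
      = conj (∫ x, (r x • φ x - (1 / 2 : ℝ) • (r₂ x • φ x))) := by
    rw [← integral_conj]
    refine integral_congr_ae (Eventually.of_forall fun x => ?_)
    simp only [Complex.real_smul, map_sub, map_mul, Complex.conj_ofReal]
    push_cast
    ring
  have i : Integrable (fun x => (1 / 2 : ℝ) • (r₂ x • φ x)) :=
    (integrable_smul_of_memLp_two hr₂ hφ.1).smul (1 / 2 : ℝ)
  rw [energyForm, e1, e2, e3, hφ.integral_smul_weakDeriv hd₁ hc hr₁ hr₂,
    integral_sub (integrable_smul_of_memLp_two hr hφ.1) i, integral_smul]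
  simp only [map_sub, map_neg, Complex.real_smul, map_mul, Complex.conj_ofReal]
  push_cast
  ring

lemma energyFormReal_eq {r r₁ r₂ : ℝ → ℝ} (hd : ∀ x, HasDerivAt r (r₁ x) x)
    (hd₁ : ∀ x, HasDerivAt r₁ (r₂ x) x) (hc : Continuous r₂) (hr : MemLp r 2 volume)
    (hr₁ : MemLp r₁ 2 volume) (hr₂ : MemLp r₂ 2 volume) {f φ : ℝ → ℝ} (hf : r =ᵐ[volume] f)
    (hφ : MemH1 φ) :
    energyFormReal f φ = ∫ x, (r x - 1 / 2 * r₂ x) * φ x := by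
  have hc₁ : Continuous r₁ := continuous_iff_continuousAt.2 fun x => (hd₁ x).continuousAt
  obtain ⟨hm, hw⟩ := memH1_of_hasDerivAt hd hc₁ hr hr₁
  have hw' := (hm.weakDeriv_congr_ae hf).trans hw
  have e1 : ∫ x, weakDeriv f x * weakDeriv φ x = ∫ x, r₁ x • weakDeriv φ x :=
    integral_congr_ae (hw'.mono fun x hx => by simp [hx])
  have e2 : ∫ x, f x * φ x = ∫ x, r x • φ x :=
    integral_congr_ae (hf.mono fun x hx => by simp [hx])
  have e3 : ∫ x, (r x - 1 / 2 * r₂ x) * φ x = ∫ x, (r x • φ x - (1 / 2 : ℝ) • (r₂ x • φ x)) :=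
    integral_congr_ae (Eventually.of_forall fun x => by simp only [smul_eq_mul]; ring)
  have i : Integrable (fun x => (1 / 2 : ℝ) • (r₂ x • φ x)) :=
    (integrable_smul_of_memLp_two hr₂ hφ.1).smul (1 / 2 : ℝ)
  rw [energyFormReal, e1, e2, e3, hφ.integral_smul_weakDeriv hd₁ hc hr₁ hr₂,
    integral_sub (integrable_smul_of_memLp_two hr hφ.1) i, integral_smul]
  simp
  ring

end SobolevFunctions

/-! ### The soliton -/

noncomputable section

section Soliton

/-- The explicit soliton `(p+1)^(1/(2p)) sech^(1/p)(√2 p x)`. -/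
def soliton (p x : ℝ) : ℝ :=
  (p + 1) ^ (1 / (2 * p)) * Real.cosh (√2 * p * x) ^ (-(1 / p))

/-- The derivative of the soliton. -/
def solitonDeriv (p x : ℝ) : ℝ := -(√2 * Real.tanh (√2 * p * x)) * soliton p x

variable {p : ℝ}

lemma hasDerivAt_tanh_real (x : ℝ) : HasDerivAt Real.tanh (1 - Real.tanh x ^ 2) x := by
  have h := (Real.hasDerivAt_sinh x).div (Real.hasDerivAt_cosh x) (Real.cosh_pos x).ne'
  have e : Real.tanh = fun x => Real.sinh x / Real.cosh x := funext Real.tanh_eq_sinh_div_cosh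
  rw [e]
  refine h.congr_deriv ?_
  have := (Real.cosh_pos x).ne'
  field_simp

lemma abs_tanh_le_one (x : ℝ) : |Real.tanh x| ≤ 1 :=
  abs_le.2 ⟨(Real.neg_one_lt_tanh x).le, (Real.tanh_lt_one x).le⟩

lemma tanh_nonneg_of_nonneg {x : ℝ} (hx : 0 ≤ x) : 0 ≤ Real.tanh x := by
  rw [Real.tanh_eq_sinh_div_cosh]
  exact div_nonneg (Real.sinh_nonneg_iff.2 hx) (Real.cosh_pos x).le

lemma soliton_pos (hp : 0 < p) (x : ℝ) : 0 < soliton p x := by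
  have := Real.cosh_pos (√2 * p * x)
  unfold soliton
  positivity

lemma soliton_even (p x : ℝ) : soliton p (-x) = soliton p x := by
  simp [soliton]

lemma soliton_zero (p : ℝ) : soliton p 0 = (p + 1) ^ (1 / (2 * p)) := by
  simp [soliton]

/-- `z^(2p) = (p+1) sech²(√2 p x)`, written through `sech² = 1 - tanh²`. -/
lemma soliton_rpow (hp : 0 < p) (x : ℝ) :
    soliton p x ^ (2 * p) = (p + 1) * (1 - Real.tanh (√2 * p * x) ^ 2) := by
  have hc := Real.cosh_pos (√2 * p * x)
  rw [soliton, Real.mul_rpow (by positivity) (by positivity), ← Real.rpow_mul (by positivity),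
    ← Real.rpow_mul hc.le, one_div_mul_cancel (by positivity), Real.rpow_one,
    show -(1 / p) * (2 * p) = -(2 : ℕ) by field_simp; norm_num, Real.rpow_neg hc.le,
    Real.rpow_natCast, Real.tanh_eq_sinh_div_cosh, div_pow, Real.sinh_sq]
  field_simp
  ring

lemma hasDerivAt_soliton (hp : 0 < p) (x : ℝ) :
    HasDerivAt (soliton p) (solitonDeriv p x) x := by
  have hc := Real.cosh_pos (√2 * p * x)
  have h1 : HasDerivAt (fun x => √2 * p * x) (√2 * p) x := by
    simpa using (hasDerivAt_id x).const_mul (√2 * p)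
  have h2 := (((Real.hasDerivAt_cosh _).comp x h1).rpow_const (p := -(1 / p))
    (Or.inl hc.ne')).const_mul ((p + 1) ^ (1 / (2 * p)))
  refine h2.congr_deriv ?_
  simp only [solitonDeriv, soliton, Function.comp, Real.tanh_eq_sinh_div_cosh]
  rw [Real.rpow_sub hc, Real.rpow_one]
  field_simp

lemma hasDerivAt_tanh_scaled (p x : ℝ) : HasDerivAt (fun x => Real.tanh (√2 * p * x))
    ((1 - Real.tanh (√2 * p * x) ^ 2) * (√2 * p)) x := by
  have h1 : HasDerivAt (fun x => √2 * p * x) (√2 * p) x := by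
    simpa using (hasDerivAt_id x).const_mul (√2 * p)
  exact (hasDerivAt_tanh_real _).comp x h1

lemma hasDerivAt_solitonDeriv (hp : 0 < p) (x : ℝ) :
    HasDerivAt (solitonDeriv p) (2 * (1 - soliton p x ^ (2 * p)) * soliton p x) x := by
  have h := (((hasDerivAt_tanh_scaled p x).const_mul √2).fun_neg).fun_mul (hasDerivAt_soliton hp x)
  refine h.congr_deriv ?_
  rw [soliton_rpow hp, solitonDeriv]
  have h2 : √2 * √2 = 2 := Real.mul_self_sqrt (by norm_num)
  linear_combination (-p * (1 - Real.tanh (√2 * p * x) ^ 2) * soliton p x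
    + Real.tanh (√2 * p * x) ^ 2 * soliton p x) * h2

/-- The first integral of the soliton equation. -/
lemma solitonDeriv_sq (hp : 0 < p) (x : ℝ) :
    solitonDeriv p x ^ 2
      = 2 * soliton p x ^ 2 - 2 / (p + 1) * (soliton p x ^ (2 * p) * soliton p x ^ 2) := by
  rw [soliton_rpow hp, solitonDeriv, mul_pow, neg_sq, mul_pow, Real.sq_sqrt (by norm_num)]
  field_simp
  ring

lemma contDiff_soliton (p : ℝ) {n : WithTop ℕ∞} : ContDiff ℝ n (soliton p) := by
  unfold soliton
  refine contDiff_const.mul (ContDiff.rpow_const_of_ne ?_ fun x => (Real.cosh_pos _).ne')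
  exact Real.contDiff_cosh.comp (contDiff_const.mul contDiff_id)

lemma continuous_soliton (p : ℝ) : Continuous (soliton p) :=
  (contDiff_soliton p (n := 0)).continuous

lemma continuous_solitonDeriv (hp : 0 < p) : Continuous (solitonDeriv p) :=
  continuous_iff_continuousAt.2 fun x => (hasDerivAt_solitonDeriv hp x).continuousAt

lemma abs_solitonDeriv_le (hp : 0 < p) (x : ℝ) : |solitonDeriv p x| ≤ √2 * soliton p x := by
  rw [solitonDeriv, abs_mul, abs_neg, abs_mul, abs_of_pos (soliton_pos hp x),
    abs_of_nonneg (Real.sqrt_nonneg 2)]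
  have := abs_tanh_le_one (√2 * p * x)
  have := (soliton_pos hp x).le
  have := Real.sqrt_nonneg 2
  gcongr
  nlinarith

lemma integrable_exp_neg_mul_abs {c : ℝ} (hc : 0 < c) :
    Integrable (fun x : ℝ => Real.exp (-(c * |x|))) := by
  have h1 : IntegrableOn (fun x : ℝ => Real.exp (-(c * |x|))) (Ioi 0) := by
    refine (exp_neg_integrableOn_Ioi 0 hc).congr_fun (fun x hx => ?_) measurableSet_Ioi
    simp only [abs_of_pos (mem_Ioi.1 hx), neg_mul]
  have h2 : IntegrableOn (fun x : ℝ => Real.exp (-(c * |x|))) (Iic 0) := by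
    rw [integrableOn_Iic_iff_integrableOn_Iio]
    have := h1.comp_neg
    simpa using this
  rw [← integrableOn_univ, ← Iic_union_Ioi (a := (0 : ℝ))]
  exact h2.union h1

lemma soliton_le (hp : 0 < p) (x : ℝ) :
    soliton p x ≤ ((p + 1) ^ (1 / (2 * p)) * 2 ^ (1 / p)) * Real.exp (-(√2 * |x|)) := by
  have h2 : 0 < √2 * p := by positivity
  have hc : Real.exp (√2 * p * |x|) / 2 ≤ Real.cosh (√2 * p * x) := by
    rw [← Real.cosh_abs (√2 * p * x), abs_mul, abs_of_pos h2, Real.cosh_eq]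
    have := Real.exp_pos (-(√2 * p * |x|))
    linarith
  rw [soliton, mul_assoc ((p + 1) ^ (1 / (2 * p)))]
  gcongr
  calc Real.cosh (√2 * p * x) ^ (-(1 / p))
      ≤ (Real.exp (√2 * p * |x|) / 2) ^ (-(1 / p)) :=
        Real.rpow_le_rpow_of_nonpos (by positivity) hc (by simp [hp.le])
    _ = _ := by
        rw [Real.div_rpow (by positivity) (by norm_num), ← Real.exp_mul,
          Real.rpow_neg (by norm_num) (1 / p), div_inv_eq_mul, mul_comm]
        field_simp

lemma integrable_soliton_sq (hp : 0 < p) : Integrable (fun x => soliton p x ^ 2) := by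
  have hi := (integrable_exp_neg_mul_abs (c := √2 * 2) (by positivity)).const_mul
    (((p + 1) ^ (1 / (2 * p)) * 2 ^ (1 / p)) ^ 2)
  refine hi.mono' ((continuous_soliton p).pow 2).aestronglyMeasurable
    (Eventually.of_forall fun x => ?_)
  rw [Real.norm_of_nonneg (by positivity)]
  calc soliton p x ^ 2 ≤ (_ * Real.exp (-(√2 * |x|))) ^ 2 :=
        pow_le_pow_left₀ (soliton_pos hp x).le (soliton_le hp x) 2
    _ = _ := by
        rw [mul_pow, ← Real.exp_nat_mul]
        congr 2
        push_cast
        ring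

lemma memLp_soliton (hp : 0 < p) : MemLp (soliton p) 2 volume :=
  (memLp_two_iff_integrable_sq (continuous_soliton p).aestronglyMeasurable).2
    (integrable_soliton_sq hp)

lemma memLp_of_abs_le_soliton (hp : 0 < p) {f : ℝ → ℝ} (hf : Continuous f) {C : ℝ}
    (h : ∀ x, |f x| ≤ C * soliton p x) : MemLp f 2 volume := by
  refine ((memLp_soliton hp).const_mul C).mono hf.aestronglyMeasurable
    (Eventually.of_forall fun x => ?_)
  exact (h x).trans (le_abs_self _)

lemma memLp_solitonDeriv (hp : 0 < p) : MemLp (solitonDeriv p) 2 volume :=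
  memLp_of_abs_le_soliton hp (continuous_solitonDeriv hp) (abs_solitonDeriv_le hp)

lemma soliton_rpow_nonneg (hp : 0 < p) (x : ℝ) : 0 ≤ soliton p x ^ (2 * p) :=
  Real.rpow_nonneg (soliton_pos hp x).le _

lemma soliton_rpow_le (hp : 0 < p) (x : ℝ) : soliton p x ^ (2 * p) ≤ p + 1 := by
  rw [soliton_rpow hp]
  nlinarith [sq_nonneg (Real.tanh (√2 * p * x))]

lemma continuous_soliton_rpow (hp : 0 < p) : Continuous (fun x => soliton p x ^ (2 * p)) :=
  (continuous_soliton p).rpow_const fun x => Or.inl (soliton_pos hp x).ne'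

lemma memLp_soliton_rpow_mul (hp : 0 < p) (c d : ℝ) {f : ℝ → ℝ} (hc : Continuous f)
    (hf : MemLp f 2 volume) :
    MemLp (fun x => c * (1 - d * soliton p x ^ (2 * p)) * f x) 2 volume := by
  refine (hf.const_mul (|c| * (1 + |d| * (p + 1)))).mono ((continuous_const.mul
    (continuous_const.sub (continuous_const.mul (continuous_soliton_rpow hp)))).mul
      hc).aestronglyMeasurable (Eventually.of_forall fun x => ?_)
  have h1 := soliton_rpow_nonneg hp x
  have h2 := soliton_rpow_le hp x
  rw [norm_mul, norm_mul c, norm_mul (|c| * (1 + |d| * (p + 1))),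
    Real.norm_of_nonneg (r := |c| * (1 + |d| * (p + 1))) (by positivity), Real.norm_eq_abs c]
  gcongr
  refine (norm_sub_le _ _).trans ?_
  rw [norm_one, norm_mul, Real.norm_eq_abs, Real.norm_of_nonneg h1]
  gcongr

lemma memLp_soliton_rpow_smul (hp : 0 < p) (c : ℝ) {f : ℝ → ℝ} (hf : MemLp f 2 volume) :
    MemLp (fun x => c * soliton p x ^ (2 * p) * f x) 2 volume := by
  refine (hf.const_mul (|c| * (p + 1))).mono ((continuous_const.mul
    (continuous_soliton_rpow hp)).aestronglyMeasurable.mul hf.1)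
      (Eventually.of_forall fun x => ?_)
  have h1 := soliton_rpow_nonneg hp x
  have h2 := soliton_rpow_le hp x
  rw [norm_mul, norm_mul c, norm_mul (|c| * (p + 1)),
    Real.norm_of_nonneg (r := |c| * (p + 1)) (by positivity), Real.norm_eq_abs c,
    Real.norm_of_nonneg h1]
  gcongr

lemma tendsto_soliton_atTop (hp : 0 < p) : Tendsto (soliton p) atTop (𝓝 0) :=
  ((isAntideriv_of_hasDerivAt (hasDerivAt_soliton hp)
    (continuous_solitonDeriv hp)).tendsto_zero_of_memLp_two (memLp_soliton hp)
    (memLp_solitonDeriv hp)).1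

lemma tendsto_soliton_atBot (hp : 0 < p) : Tendsto (soliton p) atBot (𝓝 0) :=
  ((isAntideriv_of_hasDerivAt (hasDerivAt_soliton hp)
    (continuous_solitonDeriv hp)).tendsto_zero_of_memLp_two (memLp_soliton hp)
    (memLp_solitonDeriv hp)).2

end Soliton

end

/-! ### The sharp inequality for the scalar equation -/

noncomputable section

section SharpInequality

variable {p : ℝ}

/-- The potential `s²/2 - |s|^(2p+2)/(2p+2)` of the scalar equation. -/
def potential (p s : ℝ) : ℝ := 1 / 2 * s ^ 2 - 1 / (2 * p + 2) * |s| ^ (2 * p + 2)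

/-- The primitive, vanishing at `0`, of the square root of the potential. As `√` vanishes on
negative numbers, it is constant beyond the positive zero `(p+1)^(1/(2p))` of the potential. -/
def sqrtPotentialPrimitive (p s : ℝ) : ℝ := ∫ t in (0 : ℝ)..s, √(potential p t)

lemma potential_eq (hp : 0 < p) (s : ℝ) :
    potential p s = s ^ 2 / (2 * p + 2) * (p + 1 - |s| ^ (2 * p)) := by
  rcases eq_or_ne s 0 with rfl | hs
  · have : 2 * p + 2 ≠ 0 := by positivity
    simp [potential, Real.zero_rpow this]
  · rw [potential, Real.rpow_add (abs_pos.2 hs), Real.rpow_ofNat, sq_abs]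
    field_simp

lemma continuous_potential (hp : 0 < p) : Continuous (potential p) := by
  unfold potential
  refine (continuous_const.mul (continuous_pow 2)).sub (continuous_const.mul ?_)
  exact continuous_abs.rpow_const fun x => Or.inr (by positivity)

lemma potential_nonneg (hp : 0 < p) {s : ℝ} (hs : |s| ≤ (p + 1) ^ (1 / (2 * p))) :
    0 ≤ potential p s := by
  rw [potential_eq hp]
  have : |s| ^ (2 * p) ≤ p + 1 := by
    calc |s| ^ (2 * p) ≤ ((p + 1) ^ (1 / (2 * p))) ^ (2 * p) := by gcongr
      _ = p + 1 := by
        rw [← Real.rpow_mul (by positivity), one_div_mul_cancel (by positivity), Real.rpow_one]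
  have : 0 ≤ p + 1 - |s| ^ (2 * p) := by linarith
  positivity

lemma sqrt_potential_le (hp : 0 < p) (s : ℝ) :
    √(potential p s) ≤ (p + 1) ^ (1 / (2 * p)) := by
  rcases le_or_gt |s| ((p + 1) ^ (1 / (2 * p))) with h | h
  · refine (Real.sqrt_le_left (by positivity)).2 ?_
    have h1 : s ^ 2 ≤ ((p + 1) ^ (1 / (2 * p))) ^ 2 := sq_le_sq' (by linarith [neg_abs_le s])
      ((le_abs_self s).trans h)
    have h2 : 0 ≤ 1 / (2 * p + 2) * |s| ^ (2 * p + 2) := by positivity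
    rw [potential]
    nlinarith [sq_nonneg s]
  · have h0 : potential p s ≤ 0 := by
      rw [potential_eq hp]
      refine mul_nonpos_of_nonneg_of_nonpos (by positivity) ?_
      have : p + 1 ≤ |s| ^ (2 * p) := by
        calc p + 1 = ((p + 1) ^ (1 / (2 * p))) ^ (2 * p) := by
              rw [← Real.rpow_mul (by positivity), one_div_mul_cancel (by positivity),
                Real.rpow_one]
          _ ≤ _ := by gcongr
      linarith
    rw [Real.sqrt_eq_zero_of_nonpos h0]
    positivity

lemma hasDerivAt_sqrtPotentialPrimitive (hp : 0 < p) (s : ℝ) :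
    HasDerivAt (sqrtPotentialPrimitive p) (√(potential p s)) s :=
  ((continuous_potential hp).sqrt.integral_hasStrictDerivAt 0 s).hasDerivAt

lemma abs_sqrtPotentialPrimitive_sub_le (hp : 0 < p) (s t : ℝ) :
    |sqrtPotentialPrimitive p s - sqrtPotentialPrimitive p t|
      ≤ (p + 1) ^ (1 / (2 * p)) * |s - t| := by
  have := convex_univ.norm_image_sub_le_of_norm_hasDerivWithin_le (𝕜 := ℝ)
    (f := sqrtPotentialPrimitive p) (C := (p + 1) ^ (1 / (2 * p))) (x := t) (y := s)
    (fun x _ => (hasDerivAt_sqrtPotentialPrimitive hp x).hasDerivWithinAt)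
    (fun x _ => by rw [Real.norm_of_nonneg (Real.sqrt_nonneg _)]; exact sqrt_potential_le hp x)
    (mem_univ t) (mem_univ s)
  simpa using this

lemma IsAntideriv.integral_Ioi {f f' : ℝ → ℝ} (h : IsAntideriv f f')
    (hf' : Integrable f') (hl : Tendsto f atTop (𝓝 0)) (a : ℝ) : ∫ x in Ioi a, f' x = -f a := by
  have h1 := intervalIntegral_tendsto_integral_Ioi a (hf'.integrableOn (s := Ioi a)) tendsto_id
  refine tendsto_nhds_unique h1 ?_
  rw [← zero_sub]
  exact (hl.sub_const (f a)).congr fun x => h.2 a x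

lemma IsAntideriv.integral_Iic {f f' : ℝ → ℝ} (h : IsAntideriv f f')
    (hf' : Integrable f') (hl : Tendsto f atBot (𝓝 0)) (a : ℝ) : ∫ x in Iic a, f' x = f a := by
  have h1 := intervalIntegral_tendsto_integral_Iic a (hf'.integrableOn (s := Iic a)) tendsto_id
  refine tendsto_nhds_unique h1 ?_
  rw [← sub_zero (f a)]
  exact (hl.const_sub (f a)).congr fun x => h.2 x a

/-- The square completion `¼ |u'|² + V(|u|) ≥ √V(|u|) |u'|` bounds the energy of a function that
climbs from `0` to the positive zero of the potential `V` and back to `0`. -/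
lemma two_mul_sqrtPotentialPrimitive_le (hp : 0 < p) {U g : ℝ → ℂ} (h : IsAntideriv U g)
    (hU : MemLp U 2 volume) (hg : MemLp g 2 volume)
    (hle : ∀ x, ‖U x‖ ≤ (p + 1) ^ (1 / (2 * p))) {x₀ : ℝ}
    (hx₀ : ‖U x₀‖ = (p + 1) ^ (1 / (2 * p))) :
    2 * sqrtPotentialPrimitive p ((p + 1) ^ (1 / (2 * p)))
      ≤ ∫ x, (1 / 4 * ‖g x‖ ^ 2 + potential p ‖U x‖) := by
  obtain ⟨h1, h2, h3⟩ := h.norm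
  obtain ⟨l1, l2⟩ := h.tendsto_zero_of_memLp_two hU hg
  have hpot : ∀ x, 0 ≤ potential p ‖U x‖ := fun x =>
    potential_nonneg hp (by rw [abs_norm]; exact hle x)
  have hcp : Continuous fun x => potential p ‖U x‖ :=
    (continuous_potential hp).comp h.continuous.norm
  have iV : Integrable fun x => potential p ‖U x‖ := by
    refine ((integrable_norm_sq_of_memLp_two hU).const_mul (1 / 2)).mono'
      hcp.aestronglyMeasurable (Eventually.of_forall fun x => ?_)
    rw [Real.norm_of_nonneg (hpot x), potential]
    have : 0 ≤ 1 / (2 * p + 2) * |‖U x‖| ^ (2 * p + 2) := by positivity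
    linarith
  have iH : Integrable fun x => 1 / 4 * ‖g x‖ ^ 2 + potential p ‖U x‖ :=
    ((integrable_norm_sq_of_memLp_two hg).const_mul _).add iV
  set n : ℝ → ℝ := fun x => ‖U x‖
  set f' : ℝ → ℝ := fun x => √(potential p (n x)) * deriv n x
  have hb : ∀ᵐ x, |f' x| ≤ 1 / 4 * ‖g x‖ ^ 2 + potential p (n x) := by
    filter_upwards [h3] with x hx
    have e := Real.sq_sqrt (hpot x)
    have s := Real.sqrt_nonneg (potential p ‖U x‖)
    calc |f' x| = √(potential p (n x)) * |deriv n x| := by rw [abs_mul, abs_of_nonneg s]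
      _ ≤ √(potential p (n x)) * ‖g x‖ := by gcongr
      _ ≤ _ := by nlinarith [sq_nonneg (1 / 2 * ‖g x‖ - √(potential p (n x)))]
  have if' : Integrable f' := iH.mono' ((hcp.sqrt.aestronglyMeasurable).mul
    (measurable_deriv _).aestronglyMeasurable) hb
  have hf : IsAntideriv (fun x => sqrtPotentialPrimitive p (n x)) f' := by
    refine isAntideriv_of_absolutelyContinuous (fun a b => ?_) if'.locallyIntegrable ?_
    · refine ((h1.absolutelyContinuous a b).const_mul ((p + 1) ^ (1 / (2 * p)))).of_dist_le
        fun x y => ?_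
      rw [Real.dist_eq, Real.dist_eq, ← mul_sub, abs_mul,
        abs_of_nonneg (a := (p + 1) ^ (1 / (2 * p))) (by positivity)]
      exact abs_sqrtPotentialPrimitive_sub_le hp _ _
    · filter_upwards [h2] with x hx
      exact (hasDerivAt_sqrtPotentialPrimitive hp _).comp x hx
  have hG0 : Tendsto (sqrtPotentialPrimitive p) (𝓝 0) (𝓝 0) := by
    have := (hasDerivAt_sqrtPotentialPrimitive hp 0).continuousAt.tendsto
    rwa [show sqrtPotentialPrimitive p 0 = 0 from intervalIntegral.integral_same] at this
  have e1 := hf.integral_Ioi if' (hG0.comp (tendsto_zero_iff_norm_tendsto_zero.1 l1)) x₀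
  have e2 := hf.integral_Iic if' (hG0.comp (tendsto_zero_iff_norm_tendsto_zero.1 l2)) x₀
  have hn0 : n x₀ = (p + 1) ^ (1 / (2 * p)) := hx₀
  rw [hn0] at e1 e2
  have b1 : -∫ x in Ioi x₀, f' x ≤ ∫ x in Ioi x₀, (1 / 4 * ‖g x‖ ^ 2 + potential p (n x)) := by
    rw [← integral_neg]
    exact setIntegral_mono_ae if'.neg.integrableOn iH.integrableOn
      (hb.mono fun x hx => (neg_le_abs _).trans hx)
  have b2 : ∫ x in Iic x₀, f' x ≤ ∫ x in Iic x₀, (1 / 4 * ‖g x‖ ^ 2 + potential p (n x)) :=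
    setIntegral_mono_ae if'.integrableOn iH.integrableOn
      (hb.mono fun x hx => (le_abs_self _).trans hx)
  have b3 := integral_add_compl (s := Iic x₀) measurableSet_Iic iH
  rw [compl_Iic] at b3
  linarith

/-- The soliton attains equality: `¼ z'² = V(z)`, and `z` is monotone on each half line. -/
lemma integral_energy_soliton (hp : 0 < p) :
    ∫ x, (1 / 4 * solitonDeriv p x ^ 2 + potential p (soliton p x))
      = 2 * sqrtPotentialPrimitive p ((p + 1) ^ (1 / (2 * p))) := by
  have hV : ∀ x, potential p (soliton p x) = 1 / 4 * solitonDeriv p x ^ 2 := fun x => by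
    rw [solitonDeriv_sq hp, potential_eq hp, abs_of_pos (soliton_pos hp x)]
    field_simp
    ring
  have hs : ∀ x, √(potential p (soliton p x)) = 1 / 2 * |solitonDeriv p x| := fun x => by
    rw [hV, ← Real.sqrt_sq (x := 1 / 2 * |solitonDeriv p x|) (by positivity), mul_pow, sq_abs]
    norm_num
  have hi : Integrable fun x => solitonDeriv p x ^ 2 :=
    (memLp_two_iff_integrable_sq (continuous_solitonDeriv hp).aestronglyMeasurable).1
      (memLp_solitonDeriv hp)
  have hd : ∀ x, HasDerivAt (fun x => sqrtPotentialPrimitive p (soliton p x))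
      (1 / 2 * (|solitonDeriv p x| * solitonDeriv p x)) x := fun x => by
    refine ((hasDerivAt_sqrtPotentialPrimitive hp _).comp x (hasDerivAt_soliton hp x)).congr_deriv
      ?_
    rw [hs]; ring
  have hc : Continuous fun x => 1 / 2 * (|solitonDeriv p x| * solitonDeriv p x) :=
    continuous_const.mul ((continuous_solitonDeriv hp).abs.mul (continuous_solitonDeriv hp))
  have hA := isAntideriv_of_hasDerivAt hd hc
  have hi' : Integrable fun x => 1 / 2 * (|solitonDeriv p x| * solitonDeriv p x) := by
    refine (hi.const_mul (1 / 2)).mono' hc.aestronglyMeasurable (Eventually.of_forall fun x => ?_)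
    rw [Real.norm_eq_abs, abs_mul, abs_mul, abs_abs, ← sq, sq_abs]
    norm_num
  have hG0 : Tendsto (sqrtPotentialPrimitive p) (𝓝 0) (𝓝 0) := by
    have := (hasDerivAt_sqrtPotentialPrimitive hp 0).continuousAt.tendsto
    rwa [show sqrtPotentialPrimitive p 0 = 0 from intervalIntegral.integral_same] at this
  have e1 := hA.integral_Ioi hi' (hG0.comp (tendsto_soliton_atTop hp)) 0
  have e2 := hA.integral_Iic hi' (hG0.comp (tendsto_soliton_atBot hp)) 0
  rw [soliton_zero] at e1 e2
  have t0 : ∀ x, 0 ≤ x → solitonDeriv p x ≤ 0 := fun x hx => by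
    have : 0 ≤ Real.tanh (√2 * p * x) := tanh_nonneg_of_nonneg (by positivity)
    have := soliton_pos hp x
    rw [solitonDeriv]
    exact mul_nonpos_of_nonpos_of_nonneg (by simpa using by positivity) this.le
  have t1 : ∀ x, x ≤ 0 → 0 ≤ solitonDeriv p x := fun x hx => by
    have h := tanh_nonneg_of_nonneg (x := √2 * p * -x)
      (mul_nonneg (by positivity) (neg_nonneg.2 hx))
    rw [mul_neg, Real.tanh_neg, neg_nonneg] at h
    have := soliton_pos hp x
    rw [solitonDeriv]
    refine mul_nonneg ?_ this.le
    rw [neg_nonneg]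
    exact mul_nonpos_of_nonneg_of_nonpos (by positivity) h
  have f1 : ∫ x in Ioi (0 : ℝ), (1 / 4 * solitonDeriv p x ^ 2 + potential p (soliton p x))
      = -∫ x in Ioi (0 : ℝ), 1 / 2 * (|solitonDeriv p x| * solitonDeriv p x) := by
    rw [← integral_neg]
    refine setIntegral_congr_fun measurableSet_Ioi fun x hx => ?_
    simp only [hV, abs_of_nonpos (t0 x (le_of_lt hx))]
    ring
  have f2 : ∫ x in Iic (0 : ℝ), (1 / 4 * solitonDeriv p x ^ 2 + potential p (soliton p x))
      = ∫ x in Iic (0 : ℝ), 1 / 2 * (|solitonDeriv p x| * solitonDeriv p x) := by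
    refine setIntegral_congr_fun measurableSet_Iic fun x hx => ?_
    simp only [hV, abs_of_nonneg (t1 x hx)]
    ring
  have iH : Integrable fun x => 1 / 4 * solitonDeriv p x ^ 2 + potential p (soliton p x) := by
    simp only [hV]
    exact (hi.const_mul _).add (hi.const_mul _)
  rw [← integral_add_compl (s := Iic 0) measurableSet_Iic iH, compl_Iic, f1, f2, e1, e2]
  ring

lemma memH1_soliton (hp : 0 < p) : MemH1 (toComplex (soliton p)) ∧
    weakDeriv (toComplex (soliton p)) =ᵐ[volume] toComplex (solitonDeriv p) :=
  memH1_of_hasDerivAt (fun x => (hasDerivAt_soliton hp x).ofReal_comp)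
    (Complex.continuous_ofReal.comp (continuous_solitonDeriv hp))
    (memLp_toComplex (memLp_soliton hp)) (memLp_toComplex (memLp_solitonDeriv hp))

/-- The action, up to the value `D` of the kinetic term, as the integral of an energy density. -/
lemma integral_energy_eq (hp : 0 < p) {U g : ℝ → ℂ} (hU : MemH1 U) (hg : MemLp g 2 volume)
    {D : ℝ} (hD : ∫ x, ‖g x‖ ^ 2 = D) :
    ∫ x, (1 / 4 * ‖g x‖ ^ 2 + potential p ‖U x‖)
      = 1 / 2 * (1 / 2 * D + ∫ x, ‖U x‖ ^ 2) - 1 / (2 * p + 2) * ∫ x, ‖U x‖ ^ (2 * p + 2) := by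
  simp only [potential, abs_norm]
  have i1 := (integrable_norm_sq_of_memLp_two hg).const_mul (1 / 4)
  have i2 := (integrable_norm_sq_of_memLp_two hU.1).const_mul (1 / 2)
  have i3 := (hU.integrable_norm_rpow (s := 2 * p + 2) (by linarith)).const_mul (1 / (2 * p + 2))
  have i23 : Integrable fun x =>
      1 / 2 * ‖U x‖ ^ 2 - 1 / (2 * p + 2) * ‖U x‖ ^ (2 * p + 2) := i2.sub i3
  rw [integral_add i1 i23, integral_sub i2 i3, integral_const_mul, integral_const_mul,
    integral_const_mul, hD]
  ring

lemma scalarAction_soliton (hp : 0 < p) : scalarAction p (toComplex (soliton p))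
    = 2 * sqrtPotentialPrimitive p ((p + 1) ^ (1 / (2 * p))) := by
  obtain ⟨h1, h2⟩ := memH1_soliton hp
  have hw := (weakDeriv_spec h1).1
  rw [scalarAction, energyNormSq, ← integral_energy_eq hp h1 hw rfl, ← integral_energy_soliton hp]
  refine integral_congr_ae (h2.mono fun x hx => ?_)
  simp [hx, toComplex, abs_of_pos (soliton_pos hp x)]

/-- Every nonzero `H¹` function has a multiple whose action is at least that of the soliton,
namely the one whose maximum is the zero of the potential. -/
lemma exists_scaling_le_action (hp : 0 < p) {u : ℝ → ℂ} (hu : MemH1 u) (h0 : ¬ u =ᵐ[volume] 0) :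
    ∃ t : ℝ, 0 < t ∧ scalarAction p (toComplex (soliton p)) ≤ 1 / 2 * (t ^ 2 * energyNormSq u)
      - 1 / (2 * p + 2) * (t ^ (2 * p + 2) * ∫ x, ‖u x‖ ^ (2 * p + 2)) := by
  obtain ⟨U, hUu, hA, hU2, l1, l2⟩ := hu.exists_rep
  have hg := (weakDeriv_spec hu).1
  obtain ⟨x₀, hx₀⟩ := exists_forall_norm_le_of_tendsto_zero hA.continuous l1 l2
  have hM : 0 < ‖U x₀‖ := by
    refine lt_of_le_of_ne (norm_nonneg _) fun h => h0 ?_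
    refine hUu.trans (Eventually.of_forall fun x => ?_)
    have := hx₀ x
    rw [← h] at this
    exact norm_le_zero_iff.1 this
  set m : ℝ := (p + 1) ^ (1 / (2 * p))
  have hm : 0 < m := by positivity
  set t := m / ‖U x₀‖
  have ht : 0 < t := by positivity
  refine ⟨t, ht, ?_⟩
  have hn : ∀ w : ℂ, ‖(t : ℂ) * w‖ = t * ‖w‖ := fun w => by
    rw [norm_mul, Complex.norm_real, Real.norm_of_nonneg ht.le]
  have hA' : IsAntideriv (fun x => (t : ℂ) * U x) (fun x => (t : ℂ) * weakDeriv u x) := by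
    refine ⟨(hg.const_mul (t : ℂ)).locallyIntegrable (by norm_num), fun x y => ?_⟩
    rw [intervalIntegral.integral_const_mul, ← hA.2 x y, mul_sub]
  have htU := hU2.const_mul (t : ℂ)
  have htg := hg.const_mul (t : ℂ)
  have hH : MemH1 (fun x => (t : ℂ) * U x) := ⟨htU, _, htg, hA'.hasWeakDeriv⟩
  have key := two_mul_sqrtPotentialPrimitive_le hp hA' htU htg (x₀ := x₀)
    (fun x => by
      rw [hn]
      calc t * ‖U x‖ ≤ t * ‖U x₀‖ := by gcongr; exact hx₀ x
        _ = m := div_mul_cancel₀ m hM.ne')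
    (by rw [hn]; exact div_mul_cancel₀ m hM.ne')
  rw [scalarAction_soliton hp]
  refine key.trans (le_of_eq ?_)
  rw [integral_energy_eq hp hH htg rfl, energyNormSq]
  have e1 : ∫ x, ‖(t : ℂ) * weakDeriv u x‖ ^ 2 = t ^ 2 * ∫ x, ‖weakDeriv u x‖ ^ 2 := by
    simp only [hn, mul_pow]
    rw [integral_const_mul]
  have e2 : ∫ x, ‖(t : ℂ) * U x‖ ^ 2 = t ^ 2 * ∫ x, ‖u x‖ ^ 2 := by
    rw [← integral_const_mul]
    exact integral_congr_ae (hUu.mono fun x hx => by simp only [hn, mul_pow, hx])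
  have e3 : ∫ x, ‖(t : ℂ) * U x‖ ^ (2 * p + 2)
      = t ^ (2 * p + 2) * ∫ x, ‖u x‖ ^ (2 * p + 2) := by
    rw [← integral_const_mul]
    exact integral_congr_ae (hUu.mono fun x hx => by
      simp only [hn, Real.mul_rpow ht.le (norm_nonneg _), hx])
  rw [e1, e2, e3]
  ring

/-- If some multiple of a function with squared norm `N` and nonlinear term `P` has action at
least `p/(2p+2) N₀`, then `P N₀^p ≤ N^(p+1)`. -/
lemma mul_rpow_le_of_scaling_le (hp : 0 < p) {N P N₀ X : ℝ} (hN : 0 ≤ N) (hP : 0 ≤ P)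
    (hN₀ : 0 < N₀) (hX : 0 < X) (h : p * N₀ ≤ (p + 1) * (X * N) - X ^ (p + 1) * P) :
    P * N₀ ^ p ≤ N ^ (p + 1) := by
  rcases hP.eq_or_lt with rfl | hP
  · rw [zero_mul]; positivity
  rcases hN.eq_or_lt with rfl | hN
  · have : 0 < X ^ (p + 1) * P := by positivity
    have : 0 < p * N₀ := by positivity
    linarith
  set Y := (N / P) ^ (1 / p)
  have hY : 0 < Y := by positivity
  have hYp : Y ^ p = N / P := by
    rw [← Real.rpow_mul (by positivity), one_div_mul_cancel hp.ne', Real.rpow_one]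
  have hYp1 : Y ^ (p + 1) * P = Y * N := by
    rw [Real.rpow_add hY, hYp, Real.rpow_one]
    field_simp
  have hb : 1 + (p + 1) * (X / Y - 1) ≤ (X / Y) ^ (p + 1) := by
    have := one_add_mul_self_le_rpow_one_add (s := X / Y - 1) (p := p + 1)
      (by linarith [div_pos hX hY]) (by linarith)
    rwa [add_sub_cancel] at this
  have hX' : X ^ (p + 1) * P = Y * N * (X / Y) ^ (p + 1) := by
    rw [← hYp1, Real.div_rpow hX.le hY.le]
    field_simp
  have h1 : Y * N * (1 + (p + 1) * (X / Y - 1)) = (p + 1) * (X * N) - p * (Y * N) := by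
    field_simp
    ring
  have h2 : N₀ ≤ Y * N := by
    have : Y * N * (1 + (p + 1) * (X / Y - 1)) ≤ X ^ (p + 1) * P := by
      rw [hX']; gcongr
    have : p * N₀ ≤ p * (Y * N) := by linarith
    exact le_of_mul_le_mul_left this hp
  calc P * N₀ ^ p ≤ P * (Y * N) ^ p := by gcongr
    _ = N ^ (p + 1) := by
      rw [Real.mul_rpow hY.le hN.le, hYp, Real.rpow_add hN, Real.rpow_one]
      field_simp

lemma energyNormSq_nonneg (u : ℝ → ℂ) : 0 ≤ energyNormSq u := by
  have h1 : 0 ≤ ∫ x, ‖weakDeriv u x‖ ^ 2 := integral_nonneg fun x => by positivity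
  have h2 : 0 ≤ ∫ x, ‖u x‖ ^ 2 := integral_nonneg fun x => by positivity
  rw [energyNormSq]
  positivity

lemma energyNormSq_pos {u : ℝ → ℂ} (hu : MemH1 u) (h0 : ¬ u =ᵐ[volume] 0) :
    0 < energyNormSq u := by
  have h1 : 0 ≤ ∫ x, ‖weakDeriv u x‖ ^ 2 := integral_nonneg fun x => by positivity
  have h2 : 0 ≤ ∫ x, ‖u x‖ ^ 2 := integral_nonneg fun x => by positivity
  have h3 : ∫ x, ‖u x‖ ^ 2 ≠ 0 := fun h => h0 <| by
    rw [integral_eq_zero_iff_of_nonneg (fun x => by positivity)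
      (integrable_norm_sq_of_memLp_two hu.1)] at h
    exact h.mono fun x hx => by simpa using hx
  have : 0 < ∫ x, ‖u x‖ ^ 2 := lt_of_le_of_ne h2 h3.symm
  rw [energyNormSq]
  positivity

lemma toComplex_not_ae_zero {r : ℝ → ℝ} (hr : ∀ x, 0 < r x) : ¬ toComplex r =ᵐ[volume] 0 := by
  intro h
  have : ∀ᵐ _ : ℝ, False := h.mono fun x hx => (hr x).ne' (by simpa [toComplex] using hx)
  simp [ae_iff] at this

/-- The soliton solves the scalar equation weakly. -/
lemma isScalarSolution_soliton (hp : 0 < p) : IsScalarSolution p (toComplex (soliton p)) := by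
  refine ⟨(memH1_soliton hp).1, fun φ hφ => ?_⟩
  have hc : Continuous fun x => 2 * (1 - soliton p x ^ (2 * p)) * soliton p x :=
    (continuous_const.mul (continuous_const.sub (continuous_soliton_rpow hp))).mul
      (continuous_soliton p)
  have m₂ : MemLp (fun x => 2 * (1 - soliton p x ^ (2 * p)) * soliton p x) 2 volume := by
    simpa only [one_mul] using
      memLp_soliton_rpow_mul hp 2 1 (continuous_soliton p) (memLp_soliton hp)
  rw [energyForm_toComplex_eq (hasDerivAt_soliton hp) (hasDerivAt_solitonDeriv hp) hc
    (memLp_soliton hp) (memLp_solitonDeriv hp) m₂ hφ]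
  refine integral_congr_ae (Eventually.of_forall fun x => ?_)
  simp only [toComplex, Complex.norm_real, Real.norm_of_nonneg (soliton_pos hp x).le]
  push_cast
  ring

lemma IsScalarSolution.energyNormSq_eq (hp : 0 < p) {u : ℝ → ℂ} (h : IsScalarSolution p u) :
    energyNormSq u = ∫ x, ‖u x‖ ^ (2 * p + 2) := by
  have h1 := h.2 u h.1
  rw [energyForm_self] at h1
  have h2 : ∫ x, ((‖u x‖ ^ (2 * p) : ℝ) : ℂ) * u x * conj (u x)
      = ((∫ x, ‖u x‖ ^ (2 * p + 2) : ℝ) : ℂ) := by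
    rw [← integral_complex_ofReal]
    refine integral_congr_ae (Eventually.of_forall fun x => ?_)
    simp only
    rw [mul_assoc, Complex.mul_conj, Complex.normSq_eq_norm_sq, ← Complex.ofReal_mul,
      Real.rpow_add_of_nonneg (norm_nonneg _) (by positivity) (by norm_num), Real.rpow_ofNat]
  rw [h2] at h1
  exact_mod_cast h1

lemma IsScalarSolution.scalarAction_eq (hp : 0 < p) {u : ℝ → ℂ} (h : IsScalarSolution p u) :
    scalarAction p u = p / (2 * p + 2) * energyNormSq u := by
  rw [scalarAction, ← h.energyNormSq_eq hp]
  field_simp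
  ring

/-- The sharp Gagliardo–Nirenberg inequality, with equality for the soliton. -/
lemma sharp_inequality (hp : 0 < p) {u : ℝ → ℂ} (hu : MemH1 u) (h0 : ¬ u =ᵐ[volume] 0) :
    (∫ x, ‖u x‖ ^ (2 * p + 2)) * energyNormSq (toComplex (soliton p)) ^ p
      ≤ energyNormSq u ^ (p + 1) := by
  obtain ⟨t, ht, h⟩ := exists_scaling_le_action hp hu h0
  have hz := isScalarSolution_soliton hp
  rw [hz.scalarAction_eq hp] at h
  refine mul_rpow_le_of_scaling_le hp (energyNormSq_nonneg u)
    (integral_nonneg fun x => by positivity)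
    (energyNormSq_pos hz.1 (toComplex_not_ae_zero (soliton_pos hp))) (pow_pos ht 2) ?_
  have e : (t ^ 2) ^ (p + 1) = t ^ (2 * p + 2) := by
    rw [← Real.rpow_natCast, ← Real.rpow_mul ht.le]
    congr 1
    push_cast
    ring
  rw [e]
  generalize ∫ x, ‖u x‖ ^ (2 * p + 2) = P at h ⊢
  generalize t ^ (2 * p + 2) = T at h ⊢
  have := mul_le_mul_of_nonneg_left h (show 0 ≤ 2 * p + 2 by positivity)
  field_simp at this
  linarith

lemma energyNormSq_soliton_pos (hp : 0 < p) : 0 < energyNormSq (toComplex (soliton p)) :=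
  energyNormSq_pos (memH1_soliton hp).1 (toComplex_not_ae_zero (soliton_pos hp))

/-- A nonzero `H¹` function satisfying the scalar Nehari identity has at least the energy of the
soliton. -/
lemma energyNormSq_soliton_le (hp : 0 < p) {u : ℝ → ℂ} (hu : MemH1 u) (h0 : ¬ u =ᵐ[volume] 0)
    (h : energyNormSq u = ∫ x, ‖u x‖ ^ (2 * p + 2)) :
    energyNormSq (toComplex (soliton p)) ≤ energyNormSq u := by
  have h1 := sharp_inequality hp hu h0
  have hN := energyNormSq_pos hu h0
  rw [← h, Real.rpow_add hN, Real.rpow_one, mul_comm] at h1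
  exact (Real.rpow_le_rpow_iff (energyNormSq_nonneg _) hN.le hp).1
    (le_of_mul_le_mul_right h1 hN)

end SharpInequality

end

/-! ### The inequality for two components -/

section TwoComponents

open Real

lemma tanh_le_self {x : ℝ} (hx : 0 ≤ x) : tanh x ≤ x := by
  have hd : ∀ y, HasDerivAt (fun y => y - tanh y) (1 - (1 - tanh y ^ 2)) y := fun y =>
    (hasDerivAt_id y).sub (hasDerivAt_tanh_real y)
  have hm : MonotoneOn (fun y => y - tanh y) (Ici 0) := by
    refine monotoneOn_of_deriv_nonneg (convex_Ici 0)
      (fun y _ => (hd y).continuousAt.continuousWithinAt)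
      (fun y _ => (hd y).differentiableAt.differentiableWithinAt) fun y _ => ?_
    rw [(hd y).deriv]
    nlinarith [sq_nonneg (tanh y)]
  have := hm (mem_Ici.2 le_rfl) (mem_Ici.2 hx) hx
  simp at this
  linarith

lemma mul_tanh_le_two_mul_log_cosh {x : ℝ} (hx : 0 ≤ x) : x * tanh x ≤ 2 * log (cosh x) := by
  have hd : ∀ y, HasDerivAt (fun y => 2 * log (cosh y) - y * tanh y)
      (2 * (sinh y / cosh y) - (1 * tanh y + y * (1 - tanh y ^ 2))) y := fun y =>
    (((hasDerivAt_cosh y).log (cosh_pos y).ne').const_mul 2).sub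
      ((hasDerivAt_id y).mul (hasDerivAt_tanh_real y))
  have hm : MonotoneOn (fun y => 2 * log (cosh y) - y * tanh y) (Ici 0) := by
    refine monotoneOn_of_deriv_nonneg (convex_Ici 0)
      (fun y _ => (hd y).continuousAt.continuousWithinAt)
      (fun y _ => (hd y).differentiableAt.differentiableWithinAt) fun y hy => ?_
    rw [interior_Ici] at hy
    have hy : 0 < y := hy
    rw [(hd y).deriv, tanh_eq_sinh_div_cosh]
    have hc := cosh_pos y
    have h1 : y ≤ sinh y := self_le_sinh_iff.2 hy.le
    have h2 := one_le_cosh y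
    have h3 : 2 * (sinh y / cosh y) - (1 * (sinh y / cosh y) + y * (1 - (sinh y / cosh y) ^ 2))
        = (sinh y * cosh y - y) / cosh y ^ 2 := by
      have := cosh_sq y
      field_simp
      linear_combination (-y) * this
    rw [h3]
    refine div_nonneg ?_ (by positivity)
    nlinarith
  have := hm (mem_Ici.2 le_rfl) (mem_Ici.2 hx) hx
  simp at this
  linarith

lemma one_add_tanh_mul_tanh_le {k x : ℝ} (hk : 0 ≤ k) (hx : 0 ≤ x) :
    1 + tanh (k * x / 2) * tanh x ≤ cosh x ^ k := by
  have h0 : 0 ≤ tanh x := tanh_nonneg_of_nonneg hx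
  have h1 : tanh (k * x / 2) ≤ k * x / 2 := tanh_le_self (by positivity)
  have h2 := mul_tanh_le_two_mul_log_cosh hx
  calc 1 + tanh (k * x / 2) * tanh x ≤ 1 + k * x / 2 * tanh x := by gcongr
    _ = 1 + k / 2 * (x * tanh x) := by ring
    _ ≤ 1 + k / 2 * (2 * log (cosh x)) := by gcongr
    _ = log (cosh x) * k + 1 := by ring
    _ ≤ exp (log (cosh x) * k) := add_one_le_exp _
    _ = cosh x ^ k := (rpow_def_of_pos (cosh_pos x) k).symm

/-- The case of equality between the two constraints, for `p ≥ 1`. -/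
lemma sinh_add_one_mul_le {p x : ℝ} (hp : 1 ≤ p) (hx : 0 ≤ x) :
    sinh ((p + 1) * x) ≤ (sinh x + sinh (p * x)) * cosh x ^ p := by
  set a := (p - 1) * x / 2
  have hs : 0 ≤ sinh (a + x) := sinh_nonneg_iff.2 (by
    have : a + x = (p + 1) * x / 2 := by simp only [a]; ring
    rw [this]; positivity)
  have key : cosh (a + x) ≤ cosh a * cosh x ^ p := by
    have h := one_add_tanh_mul_tanh_le (k := p - 1) (by linarith) hx
    have hc := cosh_pos x
    have hca := cosh_pos a
    rw [tanh_eq_sinh_div_cosh, tanh_eq_sinh_div_cosh, rpow_sub hc, rpow_one] at h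
    have e : cosh (a + x) = cosh a * cosh x * (1 + sinh a / cosh a * (sinh x / cosh x)) := by
      rw [cosh_add]; field_simp
    rw [e]
    calc _ ≤ cosh a * cosh x * (cosh x ^ p / cosh x) := by gcongr
      _ = _ := by field_simp
  have e1 : sinh ((p + 1) * x) = 2 * sinh (a + x) * cosh (a + x) := by
    rw [← sinh_two_mul]; congr 1; simp only [a]; ring
  have e2 : sinh x + sinh (p * x) = 2 * sinh (a + x) * cosh a := by
    have h : ∀ b, sinh (b - a) + sinh (b + a) = 2 * sinh b * cosh a := fun b => by
      rw [sinh_sub, sinh_add]; ring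
    rw [← h, add_sub_cancel_left]
    congr 2
    simp only [a]; ring
  rw [e1, e2, mul_assoc _ (cosh a)]
  gcongr

/-- At each ratio `e^(2x)` of the two components, one of the two constraints is at least as
restrictive as for equal components. -/
lemma min_constraint_le {p β x : ℝ} (hp : 0 < p) (hβ : 1 < β) (hx : 0 ≤ x) :
    exp (-(p * x)) + β * exp x ≤ (1 + β) * cosh x ^ p ∨
      exp (p * x) + β * exp (-x) ≤ (1 + β) * cosh x ^ p := by
  have hC : 1 ≤ cosh x ^ p := one_le_rpow (one_le_cosh x) hp.le
  have hex : exp (-x) ≤ 1 := exp_le_one_iff.2 (by linarith)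
  rcases le_total p 1 with h1 | h1
  · right
    have hconc := (concaveOn_rpow hp.le h1).2 (mem_Ici.2 (exp_pos x).le)
      (mem_Ici.2 (exp_pos (-x)).le) (show (0 : ℝ) ≤ 1 / 2 by norm_num)
      (show (0 : ℝ) ≤ 1 / 2 by norm_num) (by norm_num)
    have e : (1 / 2 : ℝ) • exp x + (1 / 2 : ℝ) • exp (-x) = cosh x := by
      rw [cosh_eq]; simp only [smul_eq_mul]; ring
    rw [e] at hconc
    simp only [smul_eq_mul, ← exp_mul] at hconc
    have h2 : exp (-x) ≤ exp (-x * p) := exp_le_exp.2 (by nlinarith)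
    rw [mul_comm p x]
    nlinarith
  · have hkey := sinh_add_one_mul_le h1 hx
    rcases hx.eq_or_lt with rfl | hx'
    · left; simp
    have hs : 0 < sinh x := sinh_pos_iff.2 hx'
    have e : sinh ((p + 1) * x) = sinh (p * x) * cosh x + cosh (p * x) * sinh x := by
      rw [← sinh_add]; congr 1; ring
    rw [e] at hkey
    have hc1 := cosh_sub_sinh (p * x)
    have hc2 := cosh_add_sinh (p * x)
    have hc3 := cosh_sub_sinh x
    have hc4 := cosh_add_sinh x
    rcases le_total (β * sinh x) (sinh (p * x)) with h | h
    · left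
      by_cases hb : exp x ≤ cosh x ^ p
      · have h3 : exp (-(p * x)) ≤ 1 := exp_le_one_iff.2 (by simp; positivity)
        nlinarith
      · -- The left side minus the right side increases with `β`, and it is nonpositive for the
        -- largest admissible value `β = sinh (p x) / sinh x` by `sinh_add_one_mul_le`.
        have : sinh x * (exp (-(p * x)) + β * exp x - (1 + β) * cosh x ^ p) ≤ 0 := by
          have : β * sinh x * (exp x - cosh x ^ p) ≤ sinh (p * x) * (exp x - cosh x ^ p) := by
            have : 0 ≤ exp x - cosh x ^ p := by linarith
            gcongr
          rw [← hc1, ← hc4] at *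
          nlinarith
        have := nonpos_of_mul_nonpos_right this hs
        linarith
    · right
      have : sinh x * (exp (p * x) + β * exp (-x) - (1 + β) * cosh x ^ p) ≤ 0 := by
        have : sinh (p * x) * (cosh x ^ p - exp (-x)) ≤ β * sinh x * (cosh x ^ p - exp (-x)) := by
          have : 0 ≤ cosh x ^ p - exp (-x) := by linarith
          gcongr
        rw [← hc2, ← hc3] at *
        nlinarith
      have := nonpos_of_mul_nonpos_right this hs
      linarith

/-- Among pairs satisfying both Nehari inequalities, equal components have the least sum. -/
lemma two_mul_le_add_of_constraints {p β x y : ℝ} (hp : 0 < p) (hβ : 1 < β) (hx : 0 < x)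
    (hy : 0 < y) (h1 : x ≤ x ^ (p + 1) + β * (x * y) ^ ((p + 1) / 2))
    (h2 : y ≤ y ^ (p + 1) + β * (x * y) ^ ((p + 1) / 2)) :
    2 * (1 + β) ^ (-(1 / p)) ≤ x + y := by
  wlog hxy : y ≤ x generalizing x y
  · rw [add_comm x y]
    exact this hy hx (by rwa [mul_comm y x]) (by rwa [mul_comm y x]) (le_of_not_ge hxy)
  set m := √(x * y)
  have hm : 0 < m := by positivity
  set τ := log (x / m)
  have hm2 : m * m = x * y := mul_self_sqrt (by positivity)
  have hτ : 0 ≤ τ := by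
    refine log_nonneg ((one_le_div hm).2 ?_)
    exact (sqrt_le_left hx.le).2 (by nlinarith)
  have ex : x = m * exp τ := by
    rw [exp_log (by positivity)]; field_simp
  have ey : y = m * exp (-τ) := by
    rw [exp_neg, exp_log (by positivity)]
    field_simp
    nlinarith
  have e0 : (x * y) ^ ((p + 1) / 2) = m * m ^ p := by
    rw [← hm2, mul_rpow hm.le hm.le, ← rpow_add hm, add_halves, rpow_add hm, rpow_one, mul_comm]
  have e1 : x ^ (p + 1) = m * exp τ * (m ^ p * exp (p * τ)) := by
    rw [rpow_add hx, rpow_one, ex, mul_rpow hm.le (exp_pos _).le, ← exp_mul]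
    ring_nf
  have e2 : y ^ (p + 1) = m * exp (-τ) * (m ^ p * exp (-(p * τ))) := by
    rw [rpow_add hy, rpow_one, ey, mul_rpow hm.le (exp_pos _).le, ← exp_mul]
    ring_nf
  have hee : exp τ * exp (-τ) = 1 := by rw [← exp_add]; simp
  have A : 1 ≤ m ^ p * (exp (p * τ) + β * exp (-τ)) := by
    rw [e0, e1, ex] at h1
    have : m * exp τ * 1 ≤ m * exp τ * (m ^ p * (exp (p * τ) + β * exp (-τ))) := by
      calc _ ≤ _ := (mul_one _).le.trans h1
        _ = _ := by linear_combination (-(β * m * m ^ p)) * hee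
    exact le_of_mul_le_mul_left this (by positivity)
  have B : 1 ≤ m ^ p * (exp (-(p * τ)) + β * exp τ) := by
    rw [e0, e2, ey] at h2
    have : m * exp (-τ) * 1 ≤ m * exp (-τ) * (m ^ p * (exp (-(p * τ)) + β * exp τ)) := by
      calc _ ≤ _ := (mul_one _).le.trans h2
        _ = _ := by linear_combination (-(β * m * m ^ p)) * hee
    exact le_of_mul_le_mul_left this (by positivity)
  have hmp : 0 < m ^ p := by positivity
  have C : 1 ≤ m ^ p * ((1 + β) * cosh τ ^ p) := by
    rcases min_constraint_le hp hβ hτ with h | h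
    · exact B.trans (by gcongr)
    · exact A.trans (by gcongr)
  have hc := cosh_pos τ
  have hsum : x + y = 2 * (m * cosh τ) := by
    rw [ex, ey, cosh_eq]; ring
  have h1β : 0 < 1 + β := by linarith
  have D : (1 + β)⁻¹ ≤ (m * cosh τ) ^ p := by
    rw [inv_le_iff_one_le_mul₀ h1β, mul_rpow hm.le hc.le]
    linarith
  rw [hsum]
  have : (1 + β) ^ (-(1 / p)) ≤ m * cosh τ := by
    calc (1 + β) ^ (-(1 / p)) = ((1 + β)⁻¹) ^ (1 / p) := by
          rw [rpow_neg h1β.le, inv_rpow h1β.le]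
      _ ≤ ((m * cosh τ) ^ p) ^ (1 / p) := by gcongr
      _ = m * cosh τ := by
          rw [← rpow_mul (by positivity), mul_one_div_cancel hp.ne', rpow_one]
  linarith

end TwoComponents

/-! ### Uniqueness of the scalar ground state -/

section Uniqueness

variable {p : ℝ}

lemma eq_zero_of_hasDerivAt_zero {f : ℝ → ℝ} (h : ∀ x, HasDerivAt f 0 x) (h0 : f 0 = 0) (x : ℝ) :
    f x = 0 := by
  rw [← h0]
  exact is_const_of_deriv_eq_zero (fun x => (h x).differentiableAt) (fun x => (h x).deriv) x 0

/-- The solution of `d'' = k² d` with zero initial data vanishes. -/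
lemma eq_zero_of_hasDerivAt_hasDerivAt {k : ℝ} {d d₁ : ℝ → ℝ} (h : ∀ x, HasDerivAt d (d₁ x) x)
    (h₁ : ∀ x, HasDerivAt d₁ (k ^ 2 * d x) x) (h0 : d 0 = 0) (h0' : d₁ 0 = 0) (x : ℝ) :
    d x = 0 := by
  have he : ∀ c x : ℝ, HasDerivAt (fun x => Real.exp (c * x)) (c * Real.exp (c * x)) x :=
    fun c x => by
      have := ((hasDerivAt_id x).const_mul c).exp
      simpa [mul_comm] using this
  have e1 : ∀ x, d₁ x = k * d x := fun x => by
    have := eq_zero_of_hasDerivAt_zero (f := fun x => (d₁ x - k * d x) * Real.exp (k * x))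
      (fun x => (((h₁ x).fun_sub ((h x).const_mul k)).fun_mul (he k x)).congr_deriv (by ring))
      (by simp [h0, h0']) x
    have := (mul_eq_zero.1 this).resolve_right (Real.exp_pos _).ne'
    linarith
  have := eq_zero_of_hasDerivAt_zero (f := fun x => d x * Real.exp (-k * x))
    (fun x => ((h x).mul (he (-k) x)).congr_deriv (by rw [e1]; ring)) (by simp [h0]) x
  exact (mul_eq_zero.1 this).resolve_right (Real.exp_pos _).ne'

/-- For a square integrable positive solution the first integral vanishes. -/
lemma first_integral_eq_zero (hp : 0 < p) {y y₁ : ℝ → ℝ} (hpos : ∀ x, 0 < y x)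
    (h : ∀ x, HasDerivAt y (y₁ x) x)
    (h₁ : ∀ x, HasDerivAt y₁ (2 * y x - 2 * (y x ^ (2 * p) * y x)) x)
    (hy : MemH1 (toComplex y)) (x : ℝ) :
    y₁ x ^ 2 = 2 * y x ^ 2 - 2 / (p + 1) * (y x ^ (2 * p) * y x ^ 2) := by
  have hc₁ : Continuous y₁ := continuous_iff_continuousAt.2 fun x => (h₁ x).continuousAt
  have hw := weakDeriv_spec hy
  have hanti := isAntideriv_of_hasDerivAt (fun x => (h x).ofReal_comp)
    (Complex.continuous_ofReal.comp hc₁)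
  have hm₁ : MemLp y₁ 2 volume := by
    have := (hw.1.ae_eq (hw.2.unique hanti.hasWeakDeriv)).norm
    refine this.mono hc₁.aestronglyMeasurable (Eventually.of_forall fun x => ?_)
    simp
  have hm : MemLp y 2 volume := by
    refine hy.1.norm.mono (continuous_iff_continuousAt.2
      fun x => (h x).continuousAt).aestronglyMeasurable (Eventually.of_forall fun x => ?_)
    simp [toComplex]
  have hm2 : Integrable fun x => y x ^ (2 * p) * y x ^ 2 := by
    refine (hy.integrable_norm_rpow (s := 2 * p + 2) (by linarith)).congr
      (Eventually.of_forall fun x => ?_)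
    simp only [toComplex, Complex.norm_real, Real.norm_of_nonneg (hpos x).le]
    rw [Real.rpow_add (hpos x), Real.rpow_ofNat]
  set F : ℝ → ℝ := fun x => y₁ x ^ 2 - 2 * y x ^ 2 + 2 / (p + 1) * (y x ^ (2 * p) * y x ^ 2)
  have hF : Integrable F := ((hm₁.integrable_sq).sub (hm.integrable_sq.const_mul 2)).add
    (hm2.const_mul _)
  have hd : ∀ x, HasDerivAt F 0 x := fun x => by
    have := (((h₁ x).pow 2).sub (((h x).pow 2).const_mul 2)).add
      ((((h x).rpow_const (p := 2 * p) (Or.inl (hpos x).ne')).mul ((h x).pow 2)).const_mul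
        (2 / (p + 1)))
    refine this.congr_deriv ?_
    rw [Real.rpow_sub_one (hpos x).ne']
    have := (hpos x).ne'
    simp only [Pi.pow_apply]
    field_simp
    ring
  have hconst : F = fun _ => F 0 := funext fun x =>
    is_const_of_deriv_eq_zero (fun x => (hd x).differentiableAt) (fun x => (hd x).deriv) x 0
  rw [hconst, integrable_const_iff] at hF
  have hF0 : F 0 = 0 := by
    refine hF.resolve_right fun hfin => ?_
    have := hfin.measure_univ_lt_top
    simp at this
  have : F x = 0 := by rw [hconst]; exact hF0
  simp only [F] at this
  linarith

/-- Uniqueness of the positive even `H¹` solution: `y^(-p)` solves a linear equation. -/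
lemma eq_soliton_of_positive_even (hp : 0 < p) {y y₁ : ℝ → ℝ} (hpos : ∀ x, 0 < y x)
    (heven : ∀ x, y (-x) = y x) (h : ∀ x, HasDerivAt y (y₁ x) x)
    (h₁ : ∀ x, HasDerivAt y₁ (2 * y x - 2 * (y x ^ (2 * p) * y x)) x)
    (hy : MemH1 (toComplex y)) : y = soliton p := by
  have hfi := first_integral_eq_zero hp hpos h h₁ hy
  have hy10 : y₁ 0 = 0 := by
    have h2 : HasDerivAt y (-y₁ 0) 0 := by
      have := (show HasDerivAt y (y₁ 0) (-0) by simpa using h 0).scomp 0 (hasDerivAt_neg 0)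
      have e : y ∘ Neg.neg = y := funext heven
      rw [e] at this
      simpa using this
    have := (h 0).unique h2
    linarith
  have hy0 : y 0 ^ (2 * p) = p + 1 := by
    have h2 := hfi 0
    rw [hy10] at h2
    have h3 : y 0 ^ 2 * (p + 1 - y 0 ^ (2 * p)) = 0 := by
      field_simp at h2
      linarith
    have := (mul_eq_zero.1 h3).resolve_left (pow_pos (hpos 0) 2).ne'
    linarith
  set κ := √2 * p
  have hκ : κ ^ 2 = 2 * p ^ 2 := by rw [mul_pow, Real.sq_sqrt (by norm_num)]
  set c : ℝ := y 0 ^ (-p)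
  have hcosh : ∀ x, HasDerivAt (fun x => c * Real.cosh (κ * x)) (c * (Real.sinh (κ * x) * κ)) x :=
    fun x => by
      have h1 : HasDerivAt (fun x => κ * x) κ x := by simpa using (hasDerivAt_id x).const_mul κ
      exact ((Real.hasDerivAt_cosh _).comp x h1).const_mul c
  have hsinh : ∀ x, HasDerivAt (fun x => c * (Real.sinh (κ * x) * κ))
      (c * (Real.cosh (κ * x) * κ * κ)) x := fun x => by
    have h1 : HasDerivAt (fun x => κ * x) κ x := by simpa using (hasDerivAt_id x).const_mul κ
    exact (((Real.hasDerivAt_sinh _).comp x h1).mul_const κ).const_mul c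
  have key := eq_zero_of_hasDerivAt_hasDerivAt (k := κ)
    (d := fun x => y x ^ (-p) - c * Real.cosh (κ * x))
    (d₁ := fun x => y₁ x * (-p) * y x ^ (-p - 1) - c * (Real.sinh (κ * x) * κ))
    (fun x => ((h x).rpow_const (Or.inl (hpos x).ne')).sub (hcosh x))
    (fun x => by
      have := ((((h₁ x).mul_const (-p)).mul ((h x).rpow_const (p := -p - 1)
        (Or.inl (hpos x).ne')))).sub (hsinh x)
      refine this.congr_deriv ?_
      have hx := (hpos x).ne'
      simp only [Real.rpow_sub_one hx]
      rw [mul_assoc _ κ κ, ← sq, hκ]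
      have := hfi x
      field_simp
      field_simp at this
      linear_combination y x ^ (-p) * this)
    (by simp [c]) (by simp [hy10])
  funext x
  have e1 : y x ^ (-p) = c * Real.cosh (κ * x) := by have := key x; linarith
  have hc := Real.cosh_pos (κ * x)
  have e2 : y x = (y x ^ (-p)) ^ (-(1 / p)) := by
    rw [← Real.rpow_mul (hpos x).le, neg_mul_neg, mul_one_div_cancel hp.ne', Real.rpow_one]
  have e3 : c ^ (-(1 / p)) = (p + 1) ^ (1 / (2 * p)) := by
    rw [← hy0, ← Real.rpow_mul (hpos 0).le, ← Real.rpow_mul (hpos 0).le]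
    congr 1
    field_simp
  rw [e2, e1, Real.mul_rpow (Real.rpow_nonneg (hpos 0).le _) hc.le, e3, soliton]

lemma IsScalarGroundState.eq_soliton (hp : 0 < p) {y : ℝ → ℝ} (hy : IsScalarGroundState p y) :
    y = soliton p := by
  have h1 : ContDiff ℝ 1 (deriv y) :=
    ((contDiff_succ_iff_deriv (n := 1)).1 hy.contDiff).2.2
  refine eq_soliton_of_positive_even (y₁ := deriv y) hp hy.pos hy.even
    (fun x => ((hy.contDiff.differentiable (by norm_num)) x).hasDerivAt)
    (fun x => ?_) hy.solution.1
  have := ((h1.differentiable (by norm_num)) x).hasDerivAt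
  refine this.congr_deriv ?_
  have h2 := hy.equation x
  rw [Real.rpow_add (hy.pos x), Real.rpow_one] at h2
  linarith

lemma isScalarGroundState_soliton (hp : 0 < p) : IsScalarGroundState p (soliton p) where
  contDiff := contDiff_soliton p
  pos := soliton_pos hp
  even := soliton_even p
  equation x := by
    have e1 : deriv (soliton p) = solitonDeriv p := funext fun x => (hasDerivAt_soliton hp x).deriv
    rw [e1, (hasDerivAt_solitonDeriv hp x).deriv, Real.rpow_add (soliton_pos hp x), Real.rpow_one]
    ring
  solution := isScalarSolution_soliton hp
  least u hu h0 := by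
    have hz := isScalarSolution_soliton hp
    rw [hz.scalarAction_eq hp, hu.scalarAction_eq hp]
    have := energyNormSq_soliton_le hp hu.1 h0 (hu.energyNormSq_eq hp)
    gcongr

end Uniqueness

/-! ### The scalar linearized equation -/

noncomputable section LinearizedScalar

variable {p μ : ℝ}

lemma hasDerivAt_soliton_rpow (hp : 0 < p) (x : ℝ) :
    HasDerivAt (fun x => soliton p x ^ (2 * p))
      (-(2 * p * √2 * Real.tanh (√2 * p * x)) * soliton p x ^ (2 * p)) x := by
  have hz := (soliton_pos hp x).ne'
  refine ((hasDerivAt_soliton hp x).rpow_const (p := 2 * p) (Or.inl hz)).congr_deriv ?_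
  rw [Real.rpow_sub_one hz, solitonDeriv]
  field_simp

lemma hasDerivAt_soliton_rpow_mul (hp : 0 < p) (x : ℝ) :
    HasDerivAt (fun x => soliton p x ^ (2 * p) * soliton p x)
      (-((2 * p + 1) * √2 * Real.tanh (√2 * p * x)) * (soliton p x ^ (2 * p) * soliton p x)) x := by
  refine ((hasDerivAt_soliton_rpow hp x).fun_mul (hasDerivAt_soliton hp x)).congr_deriv ?_
  rw [solitonDeriv]
  ring

lemma hasDerivAt_soliton_rpow_mul_sq (hp : 0 < p) (x : ℝ) :
    HasDerivAt (fun x => soliton p x ^ (2 * p) * soliton p x ^ 2)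
      (-((2 * p + 2) * √2 * Real.tanh (√2 * p * x)) *
        (soliton p x ^ (2 * p) * soliton p x ^ 2)) x := by
  refine ((hasDerivAt_soliton_rpow hp x).fun_mul
    ((hasDerivAt_soliton hp x).fun_pow 2)).congr_deriv ?_
  rw [solitonDeriv]
  ring

/-- The Wronskian of `g` and the soliton. -/
def solitonWronskian (p : ℝ) (g g₁ : ℝ → ℝ) (x : ℝ) : ℝ :=
  g₁ x * soliton p x - g x * solitonDeriv p x

/-- The numerator of the derivative of `W / z^(2p+2)`, where `W` is the Wronskian of `g` and the
soliton `z`. -/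
def solitonWronskianAux (p μ : ℝ) (g g₁ : ℝ → ℝ) (x : ℝ) : ℝ :=
  -(2 * (μ - 1)) * (soliton p x ^ (2 * p) * soliton p x * g x)
    + (2 * p + 2) * √2 * Real.tanh (√2 * p * x) * solitonWronskian p g g₁ x

variable {g g₁ : ℝ → ℝ}

lemma hasDerivAt_solitonWronskian (hp : 0 < p) (h : ∀ x, HasDerivAt g (g₁ x) x)
    (h₁ : ∀ x, HasDerivAt g₁ (2 * (1 - μ * soliton p x ^ (2 * p)) * g x) x) (x : ℝ) :
    HasDerivAt (solitonWronskian p g g₁)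
      (-(2 * (μ - 1)) * (soliton p x ^ (2 * p) * soliton p x * g x)) x := by
  refine (((h₁ x).fun_mul (hasDerivAt_soliton hp x)).fun_sub
    ((h x).fun_mul (hasDerivAt_solitonDeriv hp x))).congr_deriv ?_
  ring

lemma hasDerivAt_solitonWronskianAux (hp : 0 < p) (h : ∀ x, HasDerivAt g (g₁ x) x)
    (h₁ : ∀ x, HasDerivAt g₁ (2 * (1 - μ * soliton p x ^ (2 * p)) * g x) x) (x : ℝ) :
    HasDerivAt (solitonWronskianAux p μ g g₁)
      (2 * (2 * p + 1 - μ) * soliton p x ^ (2 * p) * solitonWronskian p g g₁ x) x := by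
  refine ((((hasDerivAt_soliton_rpow_mul hp x).fun_mul (h x)).const_mul (-(2 * (μ - 1)))).fun_add
    (((hasDerivAt_tanh_scaled p x).const_mul ((2 * p + 2) * √2)).fun_mul
      (hasDerivAt_solitonWronskian hp h h₁ x))).congr_deriv ?_
  have e := soliton_rpow hp x
  have h2 : √2 * √2 = 2 := Real.mul_self_sqrt (by norm_num)
  rw [solitonWronskian, solitonDeriv]
  generalize soliton p x ^ (2 * p) = q at *
  generalize Real.tanh (√2 * p * x) = T at *
  linear_combination ((2 * p + 2) * p * (1 - T ^ 2) *
    (g₁ x * soliton p x + g x * (√2 * T * soliton p x))) * h2 -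
    4 * p * (g₁ x * soliton p x + g x * (√2 * T * soliton p x)) * e

lemma hasDerivAt_solitonWronskian_div (hp : 0 < p) (h : ∀ x, HasDerivAt g (g₁ x) x)
    (h₁ : ∀ x, HasDerivAt g₁ (2 * (1 - μ * soliton p x ^ (2 * p)) * g x) x) (x : ℝ) :
    HasDerivAt (fun x => solitonWronskian p g g₁ x / (soliton p x ^ (2 * p) * soliton p x ^ 2))
      (solitonWronskianAux p μ g g₁ x / (soliton p x ^ (2 * p) * soliton p x ^ 2)) x := by
  have hz := soliton_pos hp x
  have hq : 0 < soliton p x ^ (2 * p) := Real.rpow_pos_of_pos hz _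
  refine ((hasDerivAt_solitonWronskian hp h h₁ x).fun_div (hasDerivAt_soliton_rpow_mul_sq hp x)
    (by positivity)).congr_deriv ?_
  rw [solitonWronskianAux]
  generalize soliton p x ^ (2 * p) = q at *
  field_simp
  ring

lemma tendsto_soliton_rpow (hp : 0 < p) {l : Filter ℝ} (hz : Tendsto (soliton p) l (𝓝 0)) :
    Tendsto (fun x => soliton p x ^ (2 * p)) l (𝓝 0) := by
  have := hz.rpow_const (p := 2 * p) (Or.inr (by positivity))
  rwa [Real.zero_rpow (by positivity)] at this

lemma tanh_sq_eq (hp : 0 < p) (x : ℝ) :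
    Real.tanh (√2 * p * x) ^ 2 = 1 - soliton p x ^ (2 * p) / (p + 1) := by
  rw [soliton_rpow hp]
  field_simp
  ring

lemma tendsto_tanh_sq (hp : 0 < p) {l : Filter ℝ} (hz : Tendsto (soliton p) l (𝓝 0)) :
    Tendsto (fun x => Real.tanh (√2 * p * x) ^ 2) l (𝓝 1) := by
  simp only [tanh_sq_eq hp]
  simpa using ((tendsto_soliton_rpow hp hz).div_const (p + 1)).const_sub 1

lemma tendsto_mul_tanh {l : Filter ℝ} (p : ℝ) {f : ℝ → ℝ} (hf : Tendsto f l (𝓝 0)) :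
    Tendsto (fun x => f x * Real.tanh (√2 * p * x)) l (𝓝 0) :=
  hf.zero_mul_isBoundedUnder_le (isBoundedUnder_of ⟨1, fun _ => abs_tanh_le_one _⟩)

/-- The quotient of derivatives in l'Hôpital's rule for `W / z^(2p+1)`. -/
lemma tendsto_deriv_quotient (hp : 0 < p) {l : Filter ℝ} (hz : Tendsto (soliton p) l (𝓝 0))
    (hg : Tendsto g l (𝓝 0)) :
    Tendsto (fun x => -(2 * (μ - 1)) * (soliton p x ^ (2 * p) * soliton p x * g x) /
      (-((2 * p + 1) * √2 * Real.tanh (√2 * p * x)) * (soliton p x ^ (2 * p) * soliton p x)))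
      l (𝓝 0) := by
  have h1 := ((tendsto_mul_tanh p hg).div (tendsto_tanh_sq hp hz) one_ne_zero).const_mul
    (2 * (μ - 1) / ((2 * p + 1) * √2))
  simp only [zero_div, mul_zero] at h1
  refine h1.congr fun x => ?_
  have hx := soliton_pos hp x
  have hq : 0 < soliton p x ^ (2 * p) := Real.rpow_pos_of_pos hx _
  simp only [Pi.div_apply]
  rcases eq_or_ne (Real.tanh (√2 * p * x)) 0 with h | h
  · simp [h]
  · field_simp

lemma eventually_deriv_ne_zero (hp : 0 < p) {l : Filter ℝ} (hz : Tendsto (soliton p) l (𝓝 0)) :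
    ∀ᶠ x in l, -((2 * p + 1) * √2 * Real.tanh (√2 * p * x)) *
      (soliton p x ^ (2 * p) * soliton p x) ≠ 0 := by
  filter_upwards [(tendsto_tanh_sq hp hz).eventually_ne one_ne_zero] with x hx
  have h1 := soliton_pos hp x
  have h2 : 0 < soliton p x ^ (2 * p) := Real.rpow_pos_of_pos h1 _
  have h3 : Real.tanh (√2 * p * x) ≠ 0 := fun h => hx (by rw [h]; norm_num)
  have h4 : 2 * p + 1 ≠ 0 := by positivity
  simp [h1.ne', h2.ne', h3, h4]

lemma tendsto_solitonWronskian {l : Filter ℝ} (hz : Tendsto (soliton p) l (𝓝 0))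
    (hg : Tendsto g l (𝓝 0)) (hg₁ : Tendsto g₁ l (𝓝 0)) :
    Tendsto (solitonWronskian p g g₁) l (𝓝 0) := by
  have h1 := (hg₁.mul hz).add (((tendsto_mul_tanh p hg).mul hz).const_mul √2)
  simp only [mul_zero, add_zero] at h1
  refine h1.congr fun x => ?_
  rw [solitonWronskian, solitonDeriv]
  ring

/-- The boundary terms in the energy identity for `W / z^(2p+2)` vanish. -/
lemma tendsto_boundary_term (hp : 0 < p) {l : Filter ℝ} (hz : Tendsto (soliton p) l (𝓝 0))
    (hg : Tendsto g l (𝓝 0))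
    (hW : Tendsto (fun x => solitonWronskian p g g₁ x / (soliton p x ^ (2 * p) * soliton p x))
      l (𝓝 0)) :
    Tendsto (fun x => solitonWronskianAux p μ g g₁ x *
      (solitonWronskian p g g₁ x / (soliton p x ^ (2 * p) * soliton p x ^ 2))) l (𝓝 0) := by
  have h1 := ((hg.const_mul (-(2 * (μ - 1)))).add
    ((tendsto_mul_tanh p hW).const_mul ((2 * p + 2) * √2))).mul (hW.mul (tendsto_soliton_rpow hp hz))
  simp only [mul_zero, add_zero] at h1
  refine h1.congr fun x => ?_
  have hx := soliton_pos hp x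
  have hq : 0 < soliton p x ^ (2 * p) := Real.rpow_pos_of_pos hx _
  rw [solitonWronskianAux]
  generalize soliton p x ^ (2 * p) = q at *
  field_simp

/-- The energy identity: for `μ ≤ 2p+1`, a decaying solution of `-½ g'' + g = μ z^(2p) g` makes
`W / z^(2p+2)` constant, and even zero when `μ < 2p+1`. -/
lemma solitonWronskian_identity (hp : 0 < p) (hμ : μ ≤ 2 * p + 1)
    (h : ∀ x, HasDerivAt g (g₁ x) x)
    (h₁ : ∀ x, HasDerivAt g₁ (2 * (1 - μ * soliton p x ^ (2 * p)) * g x) x)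
    (ht : Tendsto g atTop (𝓝 0)) (hb : Tendsto g atBot (𝓝 0))
    (ht₁ : Tendsto g₁ atTop (𝓝 0)) (hb₁ : Tendsto g₁ atBot (𝓝 0)) (x : ℝ) :
    solitonWronskianAux p μ g g₁ x = 0 ∧ (2 * p + 1 - μ) * solitonWronskian p g g₁ x = 0 := by
  set Q : ℝ → ℝ := fun x => solitonWronskianAux p μ g g₁ x *
      (solitonWronskian p g g₁ x / (soliton p x ^ (2 * p) * soliton p x ^ 2))
  set Q' : ℝ → ℝ := fun x => (2 * (2 * p + 1 - μ) * soliton p x ^ (2 * p) *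
    solitonWronskian p g g₁ x ^ 2 + solitonWronskianAux p μ g g₁ x ^ 2) /
      (soliton p x ^ (2 * p) * soliton p x ^ 2)
  have hz := soliton_pos hp
  have hq : ∀ x, 0 < soliton p x ^ (2 * p) := fun x => Real.rpow_pos_of_pos (hz x) _
  have hμ' : 0 ≤ 2 * p + 1 - μ := by linarith
  have hQ : ∀ x, HasDerivAt Q (Q' x) x := fun x => by
    refine ((hasDerivAt_solitonWronskianAux hp h h₁ x).fun_mul
      (hasDerivAt_solitonWronskian_div hp h h₁ x)).congr_deriv ?_
    simp only [Q']
    ring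
  have hmono : Monotone Q := by
    refine monotone_of_deriv_nonneg (fun x => (hQ x).differentiableAt) fun x => ?_
    rw [(hQ x).deriv]
    have := hz x
    have := hq x
    positivity
  have hT : Tendsto Q atTop (𝓝 0) := by
    have hzt := tendsto_soliton_atTop hp
    refine tendsto_boundary_term hp hzt ht ?_
    refine HasDerivAt.lhopital_zero_atTop
      (Eventually.of_forall (hasDerivAt_solitonWronskian hp h h₁))
      (Eventually.of_forall (hasDerivAt_soliton_rpow_mul hp)) (eventually_deriv_ne_zero hp hzt)
      (tendsto_solitonWronskian hzt ht ht₁) ?_ (tendsto_deriv_quotient hp hzt ht)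
    simpa using (tendsto_soliton_rpow hp hzt).mul hzt
  have hB : Tendsto Q atBot (𝓝 0) := by
    have hzt := tendsto_soliton_atBot hp
    refine tendsto_boundary_term hp hzt hb ?_
    refine HasDerivAt.lhopital_zero_atBot
      (Eventually.of_forall (hasDerivAt_solitonWronskian hp h h₁))
      (Eventually.of_forall (hasDerivAt_soliton_rpow_mul hp)) (eventually_deriv_ne_zero hp hzt)
      (tendsto_solitonWronskian hzt hb hb₁) ?_ (tendsto_deriv_quotient hp hzt hb)
    simpa using (tendsto_soliton_rpow hp hzt).mul hzt
  have hQ0 : Q = fun _ => 0 := funext fun x =>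
    le_antisymm (hmono.ge_of_tendsto hT x) (hmono.le_of_tendsto hB x)
  have hQ'0 : Q' x = 0 := by
    have := hQ x
    rw [hQ0] at this
    exact this.unique (hasDerivAt_const x 0)
  have h3 := (div_eq_zero_iff.1 hQ'0).resolve_right
    (mul_pos (hq x) (pow_pos (hz x) 2)).ne'
  have h4 : 0 ≤ 2 * (2 * p + 1 - μ) * soliton p x ^ (2 * p) * solitonWronskian p g g₁ x ^ 2 := by
    have := hq x
    positivity
  have h5 := sq_nonneg (solitonWronskianAux p μ g g₁ x)
  refine ⟨by nlinarith, ?_⟩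
  have h6 : 2 * soliton p x ^ (2 * p) *
      ((2 * p + 1 - μ) * solitonWronskian p g g₁ x ^ 2) = 0 := by linarith
  have h7 := (mul_eq_zero.1 h6).resolve_left (by have := hq x; positivity)
  rcases mul_eq_zero.1 h7 with h8 | h8
  · rw [h8, zero_mul]
  · rw [pow_eq_zero_iff two_ne_zero |>.1 h8, mul_zero]

lemma eq_zero_of_lt (hp : 0 < p) (hμ : μ < 2 * p + 1) (hμ1 : μ ≠ 1)
    (h : ∀ x, HasDerivAt g (g₁ x) x)
    (h₁ : ∀ x, HasDerivAt g₁ (2 * (1 - μ * soliton p x ^ (2 * p)) * g x) x)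
    (ht : Tendsto g atTop (𝓝 0)) (hb : Tendsto g atBot (𝓝 0))
    (ht₁ : Tendsto g₁ atTop (𝓝 0)) (hb₁ : Tendsto g₁ atBot (𝓝 0)) (x : ℝ) : g x = 0 := by
  have hW : solitonWronskian p g g₁ = fun _ => 0 := funext fun x =>
    (mul_eq_zero.1 (solitonWronskian_identity hp hμ.le h h₁ ht hb ht₁ hb₁ x).2).resolve_left
      (by linarith)
  have h2 := hasDerivAt_solitonWronskian hp h h₁ x
  rw [hW] at h2
  have h3 := h2.unique (hasDerivAt_const x 0)
  have hz := (soliton_pos hp x)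
  have hq : 0 < soliton p x ^ (2 * p) := Real.rpow_pos_of_pos hz _
  have h4 := (mul_eq_zero.1 h3).resolve_left (by
    exact neg_ne_zero.2 (mul_ne_zero two_ne_zero (sub_ne_zero.2 hμ1)))
  exact (mul_eq_zero.1 h4).resolve_left (by positivity)

lemma eq_mul_solitonDeriv (hp : 0 < p)
    (h : ∀ x, HasDerivAt g (g₁ x) x)
    (h₁ : ∀ x, HasDerivAt g₁ (2 * (1 - (2 * p + 1) * soliton p x ^ (2 * p)) * g x) x)
    (ht : Tendsto g atTop (𝓝 0)) (hb : Tendsto g atBot (𝓝 0))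
    (ht₁ : Tendsto g₁ atTop (𝓝 0)) (hb₁ : Tendsto g₁ atBot (𝓝 0)) :
    ∃ c : ℝ, ∀ x, g x = c * solitonDeriv p x := by
  have hD := fun x => (solitonWronskian_identity hp le_rfl h h₁ ht hb ht₁ hb₁ x).1
  have hd : ∀ x, HasDerivAt (fun x => solitonWronskian p g g₁ x /
      (soliton p x ^ (2 * p) * soliton p x ^ 2)) 0 x := fun x => by
    have := hasDerivAt_solitonWronskian_div hp h h₁ x
    rwa [hD x, zero_div] at this
  set k := solitonWronskian p g g₁ 0 / (soliton p 0 ^ (2 * p) * soliton p 0 ^ 2)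
  refine ⟨-((p + 1) * k / (2 * p)), fun x => ?_⟩
  have hz := (soliton_pos hp x)
  have hq : 0 < soliton p x ^ (2 * p) := Real.rpow_pos_of_pos hz _
  have hk : solitonWronskian p g g₁ x / (soliton p x ^ (2 * p) * soliton p x ^ 2) = k :=
    is_const_of_deriv_eq_zero (fun x => (hd x).differentiableAt) (fun x => (hd x).deriv) x 0
  rw [div_eq_iff (by positivity)] at hk
  have h2 := hD x
  rw [solitonWronskianAux, hk] at h2
  rw [solitonDeriv]
  generalize soliton p x ^ (2 * p) = q at *
  generalize Real.tanh (√2 * p * x) = T at *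
  have h3 : (q * soliton p x) * (2 * p * g x
      - (p + 1) * √2 * T * (k * soliton p x)) = 0 := by
    linear_combination (-1 / 2) * h2
  have h4 := (mul_eq_zero.1 h3).resolve_left (by positivity)
  field_simp
  linarith

/-- A weak `H¹` solution of `-½ g'' + g = μ z^(2p) g` is classical, and decays with its
derivative. -/
lemma exists_classical_solution (hp : 0 < p) (hg : MemLp g 2 volume) (hg₁ : MemLp g₁ 2 volume)
    (h : HasWeakDeriv g g₁)
    (h₁ : HasWeakDeriv g₁ fun x => 2 * (1 - μ * soliton p x ^ (2 * p)) * g x) :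
    ∃ f f₁ : ℝ → ℝ, g =ᵐ[volume] f ∧ (∀ x, HasDerivAt f (f₁ x) x) ∧
      (∀ x, HasDerivAt f₁ (2 * (1 - μ * soliton p x ^ (2 * p)) * f x) x) ∧
      Tendsto f atTop (𝓝 0) ∧ Tendsto f atBot (𝓝 0) ∧
      Tendsto f₁ atTop (𝓝 0) ∧ Tendsto f₁ atBot (𝓝 0) := by
  obtain ⟨f, e, hf⟩ := h.exists_isAntideriv
  obtain ⟨f₁, e₁, hf₁⟩ := h₁.exists_isAntideriv
  have hf' := hf.congr_right e₁
  have hc : Continuous fun x => 2 * (1 - μ * soliton p x ^ (2 * p)) * f x :=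
    (continuous_const.mul (continuous_const.sub
      (continuous_const.mul (continuous_soliton_rpow hp)))).mul hf.continuous
  have hf₁' : IsAntideriv f₁ fun x => 2 * (1 - μ * soliton p x ^ (2 * p)) * f x :=
    hf₁.congr_right (e.mono fun x hx => by simp only [hx])
  have hd := hf'.hasDerivAt_of_continuous hf₁.continuous
  have hd₁ := hf₁'.hasDerivAt_of_continuous hc
  have m : MemLp f 2 volume := hg.ae_eq e
  have m₁ : MemLp f₁ 2 volume := hg₁.ae_eq e₁
  have m₂ := memLp_soliton_rpow_mul hp 2 μ hf.continuous m
  obtain ⟨t, b⟩ := hf'.tendsto_zero_of_memLp_two m m₁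
  obtain ⟨t₁, b₁⟩ := hf₁'.tendsto_zero_of_memLp_two m₁ m₂
  exact ⟨f, f₁, e, hd, hd₁, t, b, t₁, b₁⟩

end LinearizedScalar

/-! ### The coupled system -/

section CoupledSystem

variable {p β : ℝ}

lemma MemH1.integrable_norm_mul_rpow {u v : ℝ → ℂ} (hp : 0 < p) (hu : MemH1 u) (hv : MemH1 v) :
    Integrable (fun x => ‖u x * v x‖ ^ (p + 1)) := by
  have hi := (hu.integrable_norm_rpow (s := 2 * p + 2) (by linarith)).add
    (hv.integrable_norm_rpow (s := 2 * p + 2) (by linarith))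
  refine hi.mono' ((hu.1.1.mul hv.1.1).norm.aemeasurable.pow_const _).aestronglyMeasurable
    (Eventually.of_forall fun x => ?_)
  have e : ∀ w : ℂ, ‖w‖ ^ (2 * p + 2) = (‖w‖ ^ (p + 1)) ^ 2 := fun w => by
    rw [← Real.rpow_natCast, ← Real.rpow_mul (norm_nonneg _)]
    congr 1
    push_cast
    ring
  rw [Real.norm_of_nonneg (by positivity), norm_mul,
    Real.mul_rpow (norm_nonneg _) (norm_nonneg _), Pi.add_apply, e, e]
  nlinarith [sq_nonneg (‖u x‖ ^ (p + 1) - ‖v x‖ ^ (p + 1)),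
    sq_nonneg (‖u x‖ ^ (p + 1)), sq_nonneg (‖v x‖ ^ (p + 1))]

/-- The Cauchy–Schwarz inequality for the coupling term. -/
lemma integral_norm_mul_rpow_le {u v : ℝ → ℂ} (hp : 0 < p) (hu : MemH1 u) (hv : MemH1 v) :
    ∫ x, ‖u x * v x‖ ^ (p + 1) ≤
      (∫ x, ‖u x‖ ^ (2 * p + 2)) ^ (1 / 2 : ℝ) * (∫ x, ‖v x‖ ^ (2 * p + 2)) ^ (1 / 2 : ℝ) := by
  have e : ∀ w : ℂ, ‖w‖ ^ (2 * p + 2) = (‖w‖ ^ (p + 1)) ^ (2 : ℝ) := fun w => by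
    rw [← Real.rpow_mul (norm_nonneg _)]
    congr 1
    ring
  have hm : ∀ {w : ℝ → ℂ}, MemH1 w → MemLp (fun x => ‖w x‖ ^ (p + 1)) (ENNReal.ofReal 2) := by
    intro w hw
    have h2 : ENNReal.ofReal 2 = 2 := by norm_num
    rw [h2, memLp_two_iff_integrable_sq
      (hw.1.1.norm.aemeasurable.pow_const _).aestronglyMeasurable]
    refine (hw.integrable_norm_rpow (s := 2 * p + 2) (by linarith)).congr
      (Eventually.of_forall fun x => ?_)
    simp only [e, Real.rpow_two]
  have key := integral_mul_le_Lp_mul_Lq_of_nonneg (μ := volume) Real.HolderConjugate.two_two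
    (f := fun x => ‖u x‖ ^ (p + 1)) (g := fun x => ‖v x‖ ^ (p + 1))
    (Eventually.of_forall fun x => by positivity) (Eventually.of_forall fun x => by positivity)
    (hm hu) (hm hv)
  simp only [← e] at key
  refine le_trans (le_of_eq ?_) key
  refine integral_congr_ae (Eventually.of_forall fun x => ?_)
  simp only [norm_mul, Real.mul_rpow (norm_nonneg _) (norm_nonneg _)]

/-- Testing an equation of the system with its own component gives the Nehari identity. -/
lemma nehari_identity (hp : 0 < p) {u v : ℝ → ℂ} (hu : MemH1 u) (hv : MemH1 v)
    (h : ∀ φ : ℝ → ℂ, MemH1 φ → energyForm u φ =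
      ∫ x, ((‖u x‖ ^ (2 * p) + β * ‖v x‖ ^ (p + 1) * ‖u x‖ ^ (p - 1) : ℝ) : ℂ)
        * u x * conj (φ x)) :
    energyNormSq u = (∫ x, ‖u x‖ ^ (2 * p + 2)) + β * ∫ x, ‖u x * v x‖ ^ (p + 1) := by
  have h1 := h u hu
  rw [energyForm_self] at h1
  have h2 : ∫ x, ((‖u x‖ ^ (2 * p) + β * ‖v x‖ ^ (p + 1) * ‖u x‖ ^ (p - 1) : ℝ) : ℂ)
        * u x * conj (u x)
      = ((∫ x, (‖u x‖ ^ (2 * p + 2) + β * ‖u x * v x‖ ^ (p + 1)) : ℝ) : ℂ) := by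
    rw [← integral_complex_ofReal]
    refine integral_congr_ae (Eventually.of_forall fun x => ?_)
    simp only
    rw [mul_assoc, Complex.mul_conj, Complex.normSq_eq_norm_sq, ← Complex.ofReal_mul, norm_mul,
      Real.mul_rpow (norm_nonneg _) (norm_nonneg _)]
    congr 1
    rcases (norm_nonneg (u x)).eq_or_lt with h0 | h0
    · rw [← h0, Real.zero_rpow (x := 2 * p + 2) (by positivity),
        Real.zero_rpow (x := p + 1) (by positivity)]
      ring
    · rw [Real.rpow_sub_one h0.ne', Real.rpow_add h0, Real.rpow_add h0 p 1, Real.rpow_one,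
        Real.rpow_ofNat]
      field_simp
  rw [h2] at h1
  have h3 : energyNormSq u = ∫ x, (‖u x‖ ^ (2 * p + 2) + β * ‖u x * v x‖ ^ (p + 1)) := by
    exact_mod_cast h1
  rw [h3, integral_add (hu.integrable_norm_rpow (by linarith))
    ((hu.integrable_norm_mul_rpow hp hv).const_mul β), integral_const_mul]

lemma IsSolution.nehari_identities (hp : 0 < p) {u v : ℝ → ℂ} (h : IsSolution p β u v) :
    energyNormSq u = (∫ x, ‖u x‖ ^ (2 * p + 2)) + β * ∫ x, ‖u x * v x‖ ^ (p + 1) ∧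
    energyNormSq v = (∫ x, ‖v x‖ ^ (2 * p + 2)) + β * ∫ x, ‖u x * v x‖ ^ (p + 1) := by
  obtain ⟨hu, hv, h1, h2⟩ := h
  refine ⟨nehari_identity hp hu hv h1, ?_⟩
  have := nehari_identity hp hv hu h2
  simpa only [mul_comm (v _) (u _)] using this

lemma action_eq_of_nehari_identities (hp : 0 < p) {u v : ℝ → ℂ}
    (h1 : energyNormSq u = (∫ x, ‖u x‖ ^ (2 * p + 2)) + β * ∫ x, ‖u x * v x‖ ^ (p + 1))
    (h2 : energyNormSq v = (∫ x, ‖v x‖ ^ (2 * p + 2)) + β * ∫ x, ‖u x * v x‖ ^ (p + 1)) :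
    action p β u v = p / (2 * p + 2) * (energyNormSq u + energyNormSq v) := by
  rw [action]
  generalize ∫ x, ‖u x * v x‖ ^ (p + 1) = R at *
  have e1 : ∫ x, ‖u x‖ ^ (2 * p + 2) = energyNormSq u - β * R := by linarith
  have e2 : ∫ x, ‖v x‖ ^ (2 * p + 2) = energyNormSq v - β * R := by linarith
  rw [e1, e2]
  field_simp
  ring

/-- The sharp lower bound on the Nehari set. -/
lemma energyNormSq_add_ge (hp : 0 < p) (hβ : 1 < β) {U : (ℝ → ℂ) × (ℝ → ℂ)}
    (hU : U ∈ nehari p β) :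
    2 * (1 + β) ^ (-(1 / p)) * energyNormSq (toComplex (soliton p))
      ≤ energyNormSq U.1 + energyNormSq U.2 := by
  obtain ⟨u, v⟩ := U
  obtain ⟨hu, hv, hu0, hv0, h1, h2⟩ := hU
  simp only at hu hv hu0 hv0 h1 h2 ⊢
  have hN := energyNormSq_soliton_pos hp
  have hNu := energyNormSq_pos hu hu0
  have hNv := energyNormSq_pos hv hv0
  have su := sharp_inequality hp hu hu0
  have sv := sharp_inequality hp hv hv0
  have hR := integral_norm_mul_rpow_le hp hu hv
  have hPu : 0 ≤ ∫ x, ‖u x‖ ^ (2 * p + 2) := integral_nonneg fun x => by positivity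
  have hPv : 0 ≤ ∫ x, ‖v x‖ ^ (2 * p + 2) := integral_nonneg fun x => by positivity
  generalize ∫ x, ‖u x * v x‖ ^ (p + 1) = R at *
  generalize ∫ x, ‖u x‖ ^ (2 * p + 2) = P at *
  generalize ∫ x, ‖v x‖ ^ (2 * p + 2) = P' at *
  generalize energyNormSq (toComplex (soliton p)) = N at *
  set x := energyNormSq u / N
  set y := energyNormSq v / N
  have hx : 0 < x := by positivity
  have hy : 0 < y := by positivity
  have bound : ∀ {P M : ℝ}, 0 < M → P * N ^ p ≤ M ^ (p + 1) → P ≤ N * (M / N) ^ (p + 1) := by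
    intro P M hM h
    rw [Real.div_rpow hM.le hN.le, Real.rpow_add hN, Real.rpow_one]
    have : 0 < N ^ p := by positivity
    field_simp
    linarith
  have bP : P ≤ N * x ^ (p + 1) := bound hNu su
  have bP' : P' ≤ N * y ^ (p + 1) := bound hNv sv
  have bR : R ≤ N * (x * y) ^ ((p + 1) / 2) := by
    refine hR.trans ?_
    rw [← Real.mul_rpow hPu hPv]
    calc (P * P') ^ (1 / 2 : ℝ)
        ≤ ((N * x ^ (p + 1)) * (N * y ^ (p + 1))) ^ (1 / 2 : ℝ) := by gcongr
      _ = (N ^ 2 * (x * y) ^ (p + 1)) ^ (1 / 2 : ℝ) := by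
          rw [Real.mul_rpow hx.le hy.le]; ring_nf
      _ = _ := by
          rw [Real.mul_rpow (by positivity) (by positivity), ← Real.sqrt_eq_rpow,
            Real.sqrt_sq hN.le, ← Real.rpow_mul (by positivity)]
          ring_nf
  have eu : energyNormSq u = N * x := by simp only [x]; field_simp
  have ev : energyNormSq v = N * y := by simp only [y]; field_simp
  rw [eu] at h1 ⊢
  rw [ev] at h2 ⊢
  have hβ0 : 0 < β := by linarith
  have bR' : β * R ≤ β * (N * (x * y) ^ ((p + 1) / 2)) := by gcongr
  have c1 : x ≤ x ^ (p + 1) + β * (x * y) ^ ((p + 1) / 2) :=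
    le_of_mul_le_mul_left (by linarith) hN
  have c2 : y ≤ y ^ (p + 1) + β * (x * y) ^ ((p + 1) / 2) :=
    le_of_mul_le_mul_left (by linarith) hN
  have := mul_le_mul_of_nonneg_left (two_mul_le_add_of_constraints hp hβ hx hy c1 c2) hN.le
  linarith

lemma energyNormSq_const_mul_soliton (hp : 0 < p) (a : ℝ) :
    energyNormSq (toComplex fun x => a * soliton p x)
      = a ^ 2 * energyNormSq (toComplex (soliton p)) := by
  have h1 := (memH1_soliton hp).2
  have h2 : weakDeriv (toComplex fun x => a * soliton p x) =ᵐ[volume]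
      toComplex fun x => a * solitonDeriv p x :=
    (memH1_of_hasDerivAt (fun x => ((hasDerivAt_soliton hp x).const_mul a).ofReal_comp)
      (Complex.continuous_ofReal.comp (continuous_const.mul (continuous_solitonDeriv hp)))
      (memLp_toComplex ((memLp_soliton hp).const_mul a))
      (memLp_toComplex ((memLp_solitonDeriv hp).const_mul a))).2
  have e1 : ∫ x, ‖weakDeriv (toComplex fun x => a * soliton p x) x‖ ^ 2
      = a ^ 2 * ∫ x, ‖weakDeriv (toComplex (soliton p)) x‖ ^ 2 := by
    rw [← integral_const_mul]
    refine integral_congr_ae ?_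
    filter_upwards [h1, h2] with x hx1 hx2
    simp [hx1, hx2, toComplex, mul_pow]
  have e2 : ∫ x, ‖toComplex (fun x => a * soliton p x) x‖ ^ 2
      = a ^ 2 * ∫ x, ‖toComplex (soliton p) x‖ ^ 2 := by
    rw [← integral_const_mul]
    refine integral_congr_ae (Eventually.of_forall fun x => ?_)
    simp [toComplex, mul_pow]
  rw [energyNormSq, energyNormSq, e1, e2]
  ring

lemma const_mul_soliton_rpow (hp : 0 < p) {a : ℝ} (ha : 0 < a) (hβ : 1 < β)
    (haβ : a ^ (2 * p) * (1 + β) = 1) (x : ℝ) :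
    (a * soliton p x) ^ (2 * p) = soliton p x ^ (2 * p) / (1 + β) := by
  rw [Real.mul_rpow ha.le (soliton_pos hp x).le, eq_div_iff (by linarith)]
  linear_combination soliton p x ^ (2 * p) * haβ

/-- `(a z, a z)` solves the system weakly when `a^(2p) (1 + β) = 1`. -/
lemma isSolution_const_mul_soliton (hp : 0 < p) (hβ : 1 < β) {a : ℝ} (ha : 0 < a)
    (haβ : a ^ (2 * p) * (1 + β) = 1) :
    IsSolution p β (toComplex fun x => a * soliton p x) (toComplex fun x => a * soliton p x) := by
  have hd : ∀ x, HasDerivAt (fun x => a * soliton p x) (a * solitonDeriv p x) x :=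
    fun x => (hasDerivAt_soliton hp x).const_mul a
  have hd₁ : ∀ x, HasDerivAt (fun x => a * solitonDeriv p x)
      (2 * a * (1 - 1 * soliton p x ^ (2 * p)) * soliton p x) x := fun x =>
    ((hasDerivAt_solitonDeriv hp x).const_mul a).congr_deriv (by ring)
  have m := (memLp_soliton hp).const_mul a
  have m₁ := (memLp_solitonDeriv hp).const_mul a
  have m₂ := memLp_soliton_rpow_mul hp (2 * a) 1 (continuous_soliton p) (memLp_soliton hp)
  have hH : MemH1 (toComplex fun x => a * soliton p x) :=
    (memH1_of_hasDerivAt (fun x => (hd x).ofReal_comp)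
      (Complex.continuous_ofReal.comp (continuous_const.mul (continuous_solitonDeriv hp)))
      (memLp_toComplex m) (memLp_toComplex m₁)).1
  have hc₂ : Continuous fun x => 2 * a * (1 - 1 * soliton p x ^ (2 * p)) * soliton p x :=
    (continuous_const.mul (continuous_const.sub
      (continuous_const.mul (continuous_soliton_rpow hp)))).mul (continuous_soliton p)
  have key : ∀ φ : ℝ → ℂ, MemH1 φ → energyForm (toComplex fun x => a * soliton p x) φ =
      ∫ x, ((‖toComplex (fun x => a * soliton p x) x‖ ^ (2 * p) + β *
        ‖toComplex (fun x => a * soliton p x) x‖ ^ (p + 1) *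
        ‖toComplex (fun x => a * soliton p x) x‖ ^ (p - 1) : ℝ) : ℂ)
        * toComplex (fun x => a * soliton p x) x * conj (φ x) := by
    intro φ hφ
    rw [energyForm_toComplex_eq hd hd₁ hc₂ m m₁ m₂ hφ]
    refine integral_congr_ae (Eventually.of_forall fun x => ?_)
    have hz : 0 < a * soliton p x := mul_pos ha (soliton_pos hp x)
    simp only [toComplex, Complex.norm_real, Real.norm_of_nonneg hz.le]
    rw [mul_assoc β, ← Real.rpow_add hz, show p + 1 + (p - 1) = 2 * p by ring,
      const_mul_soliton_rpow hp ha hβ haβ, ← Complex.ofReal_mul]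
    congr 2
    have : 1 + β ≠ 0 := by linarith
    field_simp
    ring
  exact ⟨hH, hH, key, key⟩

/-- A weak solution of `-½ φ'' + φ = f`, tested on smooth functions of compact support. -/
lemma hasWeakDeriv_weakDeriv_of_energyFormReal {φ f : ℝ → ℝ} (hφ : MemH1 φ) (hf : MemLp f 2 volume)
    (h : ∀ η : ℝ → ℝ, MemH1 η → energyFormReal φ η = ∫ x, f x * η x) :
    HasWeakDeriv (weakDeriv φ) (fun x => 2 * (φ x - f x)) := by
  obtain ⟨hw, -⟩ := weakDeriv_spec hφ
  have hm : MemLp (fun x => 2 * (φ x - f x)) 2 volume := (hφ.1.sub hf).const_mul 2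
  refine ⟨hw.locallyIntegrable (by norm_num), hm.locallyIntegrable (by norm_num),
    fun η hη hs => ?_⟩
  have hcd : Continuous (deriv η) := hη.continuous_deriv (by simp)
  have mη : MemLp η 2 volume := hη.continuous.memLp_of_hasCompactSupport hs
  have mη' : MemLp (deriv η) 2 volume := hcd.memLp_of_hasCompactSupport hs.deriv
  obtain ⟨hη1, hη2⟩ := memH1_of_hasDerivAt
    (fun x => (hη.differentiable (by simp) x).hasDerivAt) hcd mη mη'
  have key := h η hη1
  rw [energyFormReal] at key
  have e1 : ∫ x, weakDeriv φ x * weakDeriv η x = ∫ x, deriv η x • weakDeriv φ x :=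
    integral_congr_ae (hη2.mono fun x hx => by simp [hx, mul_comm])
  have i1 : Integrable fun x => η x * φ x := integrable_smul_of_memLp_two mη hφ.1
  have i2 : Integrable fun x => η x * f x := integrable_smul_of_memLp_two mη hf
  have e2 : ∫ x, η x • (2 * (φ x - f x)) = 2 * ((∫ x, φ x * η x) - ∫ x, f x * η x) := by
    simp only [mul_comm _ (η _)]
    rw [← integral_sub i1 i2, ← integral_const_mul]
    refine integral_congr_ae (Eventually.of_forall fun x => ?_)
    simp only [smul_eq_mul]
    ring
  rw [e2, ← key, e1]
  ring

/-- The combinations `φ ± ψ` decouple the system linearized at a pair of equal components. -/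
lemma exists_classical_combination (hp : 0 < p) {c d σ : ℝ} (hσ : σ * σ = 1) {φ ψ : ℝ → ℝ}
    (hφ : MemH1 φ) (hψ : MemH1 ψ)
    (h1 : ∀ η : ℝ → ℝ, MemH1 η → energyFormReal φ η =
      ∫ x, (c * soliton p x ^ (2 * p) * φ x + d * soliton p x ^ (2 * p) * ψ x) * η x)
    (h2 : ∀ η : ℝ → ℝ, MemH1 η → energyFormReal ψ η =
      ∫ x, (c * soliton p x ^ (2 * p) * ψ x + d * soliton p x ^ (2 * p) * φ x) * η x) :
    ∃ f f₁ : ℝ → ℝ, (fun x => φ x + σ * ψ x) =ᵐ[volume] f ∧ (∀ x, HasDerivAt f (f₁ x) x) ∧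
      (∀ x, HasDerivAt f₁ (2 * (1 - (c + σ * d) * soliton p x ^ (2 * p)) * f x) x) ∧
      Tendsto f atTop (𝓝 0) ∧ Tendsto f atBot (𝓝 0) ∧
      Tendsto f₁ atTop (𝓝 0) ∧ Tendsto f₁ atBot (𝓝 0) := by
  obtain ⟨hw, hd⟩ := weakDeriv_spec hφ
  obtain ⟨kw, kd⟩ := weakDeriv_spec hψ
  have w1 := hasWeakDeriv_weakDeriv_of_energyFormReal hφ
    ((memLp_soliton_rpow_smul hp c hφ.1).add (memLp_soliton_rpow_smul hp d hψ.1)) h1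
  have w2 := hasWeakDeriv_weakDeriv_of_energyFormReal hψ
    ((memLp_soliton_rpow_smul hp c hψ.1).add (memLp_soliton_rpow_smul hp d hφ.1)) h2
  have s1 := hd.add (kd.clm_comp (σ • ContinuousLinearMap.id ℝ ℝ))
  have s2 := w1.add (w2.clm_comp (σ • ContinuousLinearMap.id ℝ ℝ))
  refine exists_classical_solution (g₁ := fun x => weakDeriv φ x + σ * weakDeriv ψ x) hp
    (hφ.1.add (hψ.1.const_mul σ)) (hw.add (kw.const_mul σ)) s1
    (s2.congr (EventuallyEq.refl _ _) (Eventually.of_forall fun x => ?_))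
  simp
  linear_combination (2 * soliton p x ^ (2 * p) * d * ψ x) * hσ

lemma isLinearizedSolution_iff (hp : 0 < p) (hβ : 1 < β) {a : ℝ} (ha : 0 < a)
    (haβ : a ^ (2 * p) * (1 + β) = 1) {φ ψ : ℝ → ℝ} :
    IsLinearizedSolution p β (fun x => a * soliton p x) (fun x => a * soliton p x) φ ψ ↔
      MemH1 φ ∧ MemH1 ψ ∧
      (∀ η : ℝ → ℝ, MemH1 η → energyFormReal φ η =
        ∫ x, ((2 * p + 1 + β * p) / (1 + β) * soliton p x ^ (2 * p) * φ x
          + β * (p + 1) / (1 + β) * soliton p x ^ (2 * p) * ψ x) * η x) ∧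
      (∀ η : ℝ → ℝ, MemH1 η → energyFormReal ψ η =
        ∫ x, ((2 * p + 1 + β * p) / (1 + β) * soliton p x ^ (2 * p) * ψ x
          + β * (p + 1) / (1 + β) * soliton p x ^ (2 * p) * φ x) * η x) := by
  have e0 : ∀ x, (2 * p + 1) * (a * soliton p x) ^ (2 * p)
      + β * p * (a * soliton p x) ^ (p - 1) * (a * soliton p x) ^ (p + 1)
      = (2 * p + 1 + β * p) / (1 + β) * soliton p x ^ (2 * p) := fun x => by
    have hz : 0 < a * soliton p x := mul_pos ha (soliton_pos hp x)
    rw [mul_assoc (β * p), ← Real.rpow_add hz, show p - 1 + (p + 1) = 2 * p by ring,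
      const_mul_soliton_rpow hp ha hβ haβ]
    ring
  have e0' : ∀ x, (2 * p + 1) * (a * soliton p x) ^ (2 * p)
      + β * p * (a * soliton p x) ^ (p + 1) * (a * soliton p x) ^ (p - 1)
      = (2 * p + 1 + β * p) / (1 + β) * soliton p x ^ (2 * p) := fun x => by
    rw [← e0 x]; ring
  have e1 : ∀ x, β * (p + 1) * (a * soliton p x) ^ p * (a * soliton p x) ^ p
      = β * (p + 1) / (1 + β) * soliton p x ^ (2 * p) := fun x => by
    have hz : 0 < a * soliton p x := mul_pos ha (soliton_pos hp x)
    rw [mul_assoc (β * (p + 1)), ← Real.rpow_add hz, show p + p = 2 * p by ring,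
      const_mul_soliton_rpow hp ha hβ haβ]
    ring
  simp only [IsLinearizedSolution, e0, e0', e1]

lemma weakDeriv_const_mul_soliton (hp : 0 < p) (a : ℝ) :
    weakDeriv (fun x => a * soliton p x) =ᵐ[volume] fun x => a * solitonDeriv p x :=
  (memH1_of_hasDerivAt (fun x => (hasDerivAt_soliton hp x).const_mul a)
    (continuous_const.mul (continuous_solitonDeriv hp)) ((memLp_soliton hp).const_mul a)
    ((memLp_solitonDeriv hp).const_mul a)).2

lemma solitonDeriv_not_ae_zero (hp : 0 < p) {a : ℝ} (ha : a ≠ 0) :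
    ¬ (fun x => a * solitonDeriv p x) =ᵐ[volume] 0 := by
  intro h
  have h0 : (fun x => a * solitonDeriv p x) = 0 :=
    Continuous.ae_eq_iff_eq volume (continuous_const.mul (continuous_solitonDeriv hp))
      continuous_zero |>.1 h
  have h1 : ∀ x, solitonDeriv p x = 0 := fun x =>
    (mul_eq_zero.1 (congrFun h0 x)).resolve_left ha
  have h2 : Tendsto (soliton p) atTop (𝓝 (soliton p 0)) := by
    refine tendsto_const_nhds.congr fun x => ?_
    exact is_const_of_deriv_eq_zero (fun x => (hasDerivAt_soliton hp x).differentiableAt)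
      (fun x => by rw [(hasDerivAt_soliton hp x).deriv, h1]) 0 x
  exact (soliton_pos hp 0).ne' (tendsto_nhds_unique h2 (tendsto_soliton_atTop hp))

/-- The multiples of `(z', z')` solve the linearized system. -/
lemma isLinearizedSolution_of_ae_eq (hp : 0 < p) (hβ : 1 < β) {a c : ℝ} (ha : 0 < a)
    (haβ : a ^ (2 * p) * (1 + β) = 1) {φ ψ : ℝ → ℝ}
    (hφ : φ =ᵐ[volume] fun x => c * solitonDeriv p x)
    (hψ : ψ =ᵐ[volume] fun x => c * solitonDeriv p x) :
    IsLinearizedSolution p β (fun x => a * soliton p x) (fun x => a * soliton p x) φ ψ := by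
  have hd : ∀ x, HasDerivAt (fun x => c * solitonDeriv p x)
      (2 * c * (1 - 1 * soliton p x ^ (2 * p)) * soliton p x) x := fun x =>
    ((hasDerivAt_solitonDeriv hp x).const_mul c).congr_deriv (by ring)
  have hd₁ : ∀ x, HasDerivAt (fun x => 2 * c * (1 - 1 * soliton p x ^ (2 * p)) * soliton p x)
      (2 * c * (1 - (2 * p + 1) * soliton p x ^ (2 * p)) * solitonDeriv p x) x := fun x => by
    refine (((((hasDerivAt_soliton_rpow hp x).const_mul 1).const_sub 1).const_mul
      (2 * c)).fun_mul (hasDerivAt_soliton hp x)).congr_deriv ?_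
    rw [solitonDeriv]
    ring
  have m := (memLp_solitonDeriv hp).const_mul c
  have m₁ := memLp_soliton_rpow_mul hp (2 * c) 1 (continuous_soliton p) (memLp_soliton hp)
  have m₂ := memLp_soliton_rpow_mul hp (2 * c) (2 * p + 1) (continuous_solitonDeriv hp)
    (memLp_solitonDeriv hp)
  have hc₁ : Continuous fun x => 2 * c * (1 - 1 * soliton p x ^ (2 * p)) * soliton p x :=
    continuous_iff_continuousAt.2 fun x => (hd₁ x).continuousAt
  have hc₂ : Continuous fun x =>
      2 * c * (1 - (2 * p + 1) * soliton p x ^ (2 * p)) * solitonDeriv p x :=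
    (continuous_const.mul (continuous_const.sub
      (continuous_const.mul (continuous_soliton_rpow hp)))).mul (continuous_solitonDeriv hp)
  have hH := (memH1_of_hasDerivAt hd hc₁ m m₁).1
  have hβ' : 1 + β ≠ 0 := by linarith
  have key : ∀ {φ ψ : ℝ → ℝ}, φ =ᵐ[volume] (fun x => c * solitonDeriv p x) →
      ψ =ᵐ[volume] (fun x => c * solitonDeriv p x) → ∀ η : ℝ → ℝ, MemH1 η →
      energyFormReal φ η =
        ∫ x, ((2 * p + 1 + β * p) / (1 + β) * soliton p x ^ (2 * p) * φ x
          + β * (p + 1) / (1 + β) * soliton p x ^ (2 * p) * ψ x) * η x := by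
    intro φ ψ hφ hψ η hη
    rw [energyFormReal_eq hd hd₁ hc₂ m m₁ m₂ hφ.symm hη]
    refine integral_congr_ae ?_
    filter_upwards [hφ, hψ] with x h1 h2
    simp only [h1, h2]
    field_simp
    ring
  exact (isLinearizedSolution_iff hp hβ ha haβ).2
    ⟨hH.congr_ae hφ.symm, hH.congr_ae hψ.symm, key hφ hψ, key hψ hφ⟩

/-- For `p ≠ β` all solutions of the linearized system are multiples of `(z', z')`: the sum of the
components has `μ = 2p+1`, and their difference has `μ = (2p+1-β)/(1+β)`. -/
lemma IsLinearizedSolution.exists_ae_eq (hp : 0 < p) (hβ : 1 < β) (hpβ : p ≠ β) {a : ℝ}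
    (ha : 0 < a) (haβ : a ^ (2 * p) * (1 + β) = 1) {φ ψ : ℝ → ℝ}
    (h : IsLinearizedSolution p β (fun x => a * soliton p x) (fun x => a * soliton p x) φ ψ) :
    ∃ c : ℝ, φ =ᵐ[volume] (fun x => c * solitonDeriv p x) ∧
      ψ =ᵐ[volume] (fun x => c * solitonDeriv p x) := by
  obtain ⟨hφ, hψ, h1, h2⟩ := (isLinearizedSolution_iff hp hβ ha haβ).1 h
  have hβ' : 0 < 1 + β := by linarith
  obtain ⟨f, f₁, e, hd, hd₁, t, b, t₁, b₁⟩ :=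
    exists_classical_combination hp (σ := 1) (by norm_num) hφ hψ h1 h2
  obtain ⟨k, k₁, e', kd, kd₁, s, r, s₁, r₁⟩ :=
    exists_classical_combination hp (σ := -1) (by norm_num) hφ hψ h1 h2
  have e1 : (2 * p + 1 + β * p) / (1 + β) + 1 * (β * (p + 1) / (1 + β)) = 2 * p + 1 := by
    field_simp
    ring
  rw [e1] at hd₁
  obtain ⟨c, hc⟩ := eq_mul_solitonDeriv hp hd hd₁ t b t₁ b₁
  have e2 : (2 * p + 1 + β * p) / (1 + β) + -1 * (β * (p + 1) / (1 + β))
      = (2 * p + 1 - β) / (1 + β) := by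
    field_simp
    ring
  rw [e2] at kd₁
  have hk := eq_zero_of_lt hp (by rw [div_lt_iff₀ hβ']; nlinarith)
    (fun h => hpβ (by rw [div_eq_one_iff_eq hβ'.ne'] at h; linarith)) kd kd₁ s r s₁ r₁
  refine ⟨c / 2, ?_, ?_⟩
  · filter_upwards [e, e'] with x h3 h4
    rw [hc] at h3
    rw [hk] at h4
    linarith
  · filter_upwards [e, e'] with x h3 h4
    rw [hc] at h3
    rw [hk] at h4
    linarith

lemma action_const_mul_soliton (hp : 0 < p) (hβ : 1 < β) {a : ℝ} (ha : 0 < a)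
    (haβ : a ^ (2 * p) * (1 + β) = 1) :
    action p β (toComplex fun x => a * soliton p x) (toComplex fun x => a * soliton p x)
      = p / (2 * p + 2) * (2 * a ^ 2 * energyNormSq (toComplex (soliton p))) := by
  obtain ⟨n1, n2⟩ := (isSolution_const_mul_soliton hp hβ ha haβ).nehari_identities hp
  rw [action_eq_of_nehari_identities hp n1 n2, energyNormSq_const_mul_soliton hp]
  ring

lemma sq_eq_of_rpow_mul_eq_one (hp : 0 < p) (hβ : 1 < β) {a : ℝ} (ha : 0 < a)
    (haβ : a ^ (2 * p) * (1 + β) = 1) : a ^ 2 = (1 + β) ^ (-(1 / p)) := by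
  have hβ' : 0 < 1 + β := by linarith
  rw [Real.rpow_neg hβ'.le, ← Real.inv_rpow hβ'.le, ← eq_inv_of_mul_eq_one_left haβ,
    ← Real.rpow_mul ha.le, ← Real.rpow_natCast]
  congr 1
  push_cast
  field_simp

/-- `(a z, a z)` minimizes the action on the Nehari set. -/
lemma action_le_of_mem_nehari (hp : 0 < p) (hβ : 1 < β) {a : ℝ} (ha : 0 < a)
    (haβ : a ^ (2 * p) * (1 + β) = 1) {u v : ℝ → ℂ} (hU : (u, v) ∈ nehari p β) :
    action p β (toComplex fun x => a * soliton p x) (toComplex fun x => a * soliton p x)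
      ≤ action p β u v := by
  have h := energyNormSq_add_ge hp hβ hU
  obtain ⟨-, -, -, -, h1, h2⟩ := hU
  rw [action_const_mul_soliton hp hβ ha haβ, action_eq_of_nehari_identities hp h1 h2,
    sq_eq_of_rpow_mul_eq_one hp hβ ha haβ]
  exact mul_le_mul_of_nonneg_left h (by positivity)

lemma IsSolution.mem_nehari (hp : 0 < p) {v₁ v₂ : ℝ → ℂ} (h : IsSolution p β v₁ v₂)
    (h1 : ¬ v₁ =ᵐ[volume] 0) (h2 : ¬ v₂ =ᵐ[volume] 0) : (v₁, v₂) ∈ nehari p β :=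
  ⟨h.1, h.2.1, h1, h2, (h.nehari_identities hp).1, (h.nehari_identities hp).2⟩

lemma isGroundState_const_mul_soliton (hp : 0 < p) (hβ : 1 < β) {a : ℝ} (ha : 0 < a)
    (haβ : a ^ (2 * p) * (1 + β) = 1) :
    IsGroundState p β (toComplex fun x => a * soliton p x)
      (toComplex fun x => a * soliton p x) := by
  have h0 : ¬ (toComplex fun x => a * soliton p x) =ᵐ[volume] 0 :=
    toComplex_not_ae_zero fun x => mul_pos ha (soliton_pos hp x)
  exact ⟨isSolution_const_mul_soliton hp hβ ha haβ, h0, h0, fun v₁ v₂ h h1 h2 =>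
    action_le_of_mem_nehari hp hβ ha haβ (h.mem_nehari hp h1 h2)⟩

/-- A nonzero solution with a vanishing component has at least the action of the scalar soliton. -/
lemma IsSolution.le_action_of_ae_zero (hp : 0 < p) {v₁ v₂ : ℝ → ℂ} (h : IsSolution p β v₁ v₂)
    (h0 : ¬ (v₁ =ᵐ[volume] 0 ∧ v₂ =ᵐ[volume] 0)) (h1 : v₁ =ᵐ[volume] 0 ∨ v₂ =ᵐ[volume] 0) :
    p / (2 * p + 2) * energyNormSq (toComplex (soliton p)) ≤ action p β v₁ v₂ := by
  obtain ⟨n1, n2⟩ := h.nehari_identities hp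
  rw [action_eq_of_nehari_identities hp n1 n2]
  have hR : ∫ x, ‖v₁ x * v₂ x‖ ^ (p + 1) = 0 := by
    refine integral_eq_zero_of_ae ?_
    have : p + 1 ≠ 0 := by positivity
    rcases h1 with h1 | h1 <;> filter_upwards [h1] with x hx <;> simp [hx, this]
  rw [hR, mul_zero, add_zero] at n1 n2
  have p1 := energyNormSq_nonneg v₁
  have p2 := energyNormSq_nonneg v₂
  have hsum : energyNormSq (toComplex (soliton p)) ≤ energyNormSq v₁ + energyNormSq v₂ := by
    by_cases h3 : v₁ =ᵐ[volume] 0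
    · have := energyNormSq_soliton_le hp h.2.1 (fun h4 => h0 ⟨h3, h4⟩) n2
      linarith
    · have := energyNormSq_soliton_le hp h.1 h3 n1
      linarith
  gcongr

lemma two_mul_rpow_le_one (hp : 0 < p) (hβ : 1 < β) (h : (2 : ℝ) ^ p ≤ 1 + β) :
    2 * (1 + β) ^ (-(1 / p)) ≤ 1 := by
  have hβ' : 0 < 1 + β := by linarith
  have : (2 : ℝ) ≤ (1 + β) ^ (1 / p) := by
    calc (2 : ℝ) = ((2 : ℝ) ^ p) ^ (1 / p) := by
          rw [← Real.rpow_mul (by norm_num), mul_one_div_cancel hp.ne', Real.rpow_one]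
      _ ≤ _ := by gcongr
  rw [Real.rpow_neg hβ'.le, ← div_eq_mul_inv]
  exact (div_le_one (by positivity)).2 this

lemma action_le_of_isSolution (hp : 0 < p) (hβ : 1 < β) {a : ℝ} (ha : 0 < a)
    (haβ : a ^ (2 * p) * (1 + β) = 1) (h2p : (2 : ℝ) ^ p ≤ 1 + β) {v₁ v₂ : ℝ → ℂ}
    (h : IsSolution p β v₁ v₂) (h0 : ¬ (v₁ =ᵐ[volume] 0 ∧ v₂ =ᵐ[volume] 0)) :
    action p β (toComplex fun x => a * soliton p x) (toComplex fun x => a * soliton p x)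
      ≤ action p β v₁ v₂ := by
  by_cases h1 : v₁ =ᵐ[volume] 0 ∨ v₂ =ᵐ[volume] 0
  · refine le_trans ?_ (h.le_action_of_ae_zero hp h0 h1)
    rw [action_const_mul_soliton hp hβ ha haβ, sq_eq_of_rpow_mul_eq_one hp hβ ha haβ]
    have hN := energyNormSq_soliton_pos hp
    have := two_mul_rpow_le_one hp hβ h2p
    gcongr
    exact mul_le_of_le_one_left hN.le this
  · rw [not_or] at h1
    exact action_le_of_mem_nehari hp hβ ha haβ (h.mem_nehari hp h1.1 h1.2)

lemma isNondegenerateGroundState_const_mul_soliton (hp : 0 < p) (hβ : 1 < β) (hpβ : p ≠ β)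
    {a : ℝ} (ha : 0 < a) (haβ : a ^ (2 * p) * (1 + β) = 1) :
    IsNondegenerateGroundState p β (fun x => a * soliton p x) (fun x => a * soliton p x) := by
  have hw := weakDeriv_const_mul_soliton hp a
  refine ⟨isGroundState_const_mul_soliton hp hβ ha haβ,
    fun h0 => solitonDeriv_not_ae_zero hp ha.ne' (hw.symm.trans h0.1),
    fun φ ψ => ⟨fun h => ?_, ?_⟩⟩
  · obtain ⟨c, h1, h2⟩ := h.exists_ae_eq hp hβ hpβ ha haβ
    refine ⟨c / a, ?_, ?_⟩
    · filter_upwards [h1, hw] with x h3 h4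
      rw [h3, h4]
      field_simp
    · filter_upwards [h2, hw] with x h3 h4
      rw [h3, h4]
      field_simp
  · rintro ⟨θ, h1, h2⟩
    refine isLinearizedSolution_of_ae_eq (c := θ * a) hp hβ ha haβ ?_ ?_
    · filter_upwards [h1, hw] with x h3 h4
      rw [h3, h4, mul_assoc]
    · filter_upwards [h2, hw] with x h3 h4
      rw [h3, h4, mul_assoc]

end CoupledSystem

theorem theorem4p1 (p : ℝ) (hp : 0 < p) :
    ∃ z : ℝ → ℝ, IsScalarGroundState p z ∧ (∀ y : ℝ → ℝ, IsScalarGroundState p y → y = z) ∧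
      ∀ β : ℝ, 1 < β → ∀ a : ℝ, a = (1 + β) ^ (-(1 / (2 * p))) →
        ∀ Z : ℝ → ℝ, Z = (fun x => a * z x) →
          IsGroundState p β (toComplex Z) (toComplex Z) ∧
          IsLeast ((fun U : (ℝ → ℂ) × (ℝ → ℂ) => action p β U.1 U.2) '' nehari p β)
            (action p β (toComplex Z) (toComplex Z)) ∧
          ((2 : ℝ) ^ p ≤ 1 + β →
            ∀ v₁ v₂ : ℝ → ℂ, IsSolution p β v₁ v₂ → ¬ (v₁ =ᵐ[volume] 0 ∧ v₂ =ᵐ[volume] 0) →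
              action p β (toComplex Z) (toComplex Z) ≤ action p β v₁ v₂) ∧
          (p ≠ β → IsNondegenerateGroundState p β Z Z) := by
  refine ⟨soliton p, isScalarGroundState_soliton hp, fun y hy => hy.eq_soliton hp, ?_⟩
  rintro β hβ a ha Z rfl
  have hβ' : 0 < 1 + β := by linarith
  have ha0 : 0 < a := by rw [ha]; exact Real.rpow_pos_of_pos hβ' _
  have haβ : a ^ (2 * p) * (1 + β) = 1 := by
    rw [ha, ← Real.rpow_mul hβ'.le, neg_mul, one_div_mul_cancel (by positivity),
      Real.rpow_neg_one, inv_mul_cancel₀ hβ'.ne']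
  have hgs := isGroundState_const_mul_soliton hp hβ ha0 haβ
  refine ⟨hgs, ⟨⟨_, hgs.1.mem_nehari hp hgs.2.1 hgs.2.2.1, rfl⟩, ?_⟩,
    fun h2p v₁ v₂ h h0 => action_le_of_isSolution hp hβ ha0 haβ h2p h h0,
    fun hpβ => isNondegenerateGroundState_const_mul_soliton hp hβ hpβ ha0 haβ⟩
  rintro _ ⟨⟨u, v⟩, hU, rfl⟩
  exact action_le_of_mem_nehari hp hβ ha0 haβ hU
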